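/- Let $X$ be a measurable space, $Y\subseteq\mathbb{R}$, $\rho$ a probability measure on $X\times Y$, $\mathcal F$ a real separable Hilbert space, and $\Phi:X\to\mathcal F$ a measurable map with $\sup_{x\in X}\|\Phi(x)\|\le\kappa<\infty$. Let $V:\mathbb{R}\times\mathbb{R}\to[0,\infty)$ be measurable, such that for every $y\in Y$ the function $V(y,\cdot)$ is convex, $V(y,0)\le V_0<\infty$, and its left-hand derivative satisfies $|V'_-(y,a)|\le a_0$ for all $a\in\mathbb{R}$. For $w\in\mathcal F$ put $\mathcal E(w)=\int V(y,\langle w,\Phi(x)\rangle)\,d\rho(x,y)$, and assume that for some $\beta\in(0,1]$ and $c_\beta>0$ $$\inf_{w\in\mathcal F}\Big\{\mathcal E(w)+\tfrac{\lambda}{2}\|w\|^2\Big\}-\inf_{w\in\mathcal F}\mathcal E(w)\le c_\beta\lambda^\beta\qquad\text{for all }\lambda>0.$$ Let $m\ge 1$, let $\mathbf z=((x_i,y_i))_{i=1}^m$ be drawn independently from $\rho$, and let $J=(j_1,j_2,\dots)$ be i.i.d. uniform on $\{1,\dots,m\}$, independent of $\mathbf z$. With step-sizes $\eta_t=1/\sqrt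 t$, $t\ge 1$, define $w_1=0$, $$w_{t+1}=w_t-\eta_t\,V'_-\big(y_{j_t},\langle w_t,\Phi(x_{j_t})\rangle\big)\,\Phi(x_{j_t}),\qquad \overline w_t=\frac{\sum_{k=1}^t\eta_k w_k}{\sum_{k=1}^t\eta_k}.$$ Then there is a constant $C>0$ depending only on $\kappa,a_0,V_0,c_\beta$ (and not on $m$ or $t$) such that, for $g_t=\overline w_t$ and likewise for $g_t=w_t$, the following hold, all expectations being well defined. For every $m\ge1$ and every $t\ge 1$, $$\mathbb{E}_{\mathbf z,J}\Big[\mathcal E(g_t)-\inf_{w\in\mathcal F}\mathcal E(w)\Big]\le C\left(\frac{t^{1/4}\log t}{\sqrt m}+\frac{\log t}{\sqrt t}+\frac{1}{t^{\beta/2}}\right).$$ In particular, for every $m\ge 2$ and $t^*=\lceil m^{2/(2\beta+1)}\rceil$, $$\mathbb{E}_{\mathbf z,J}\Big[\mathcal E(g_{t^*})-\inf_{w\in\mathcal F}\mathcal E(w)\Big]\le C\,m^{-\beta/(2\beta+1)}\log m.$$ -/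

import Mathlib

open MeasureTheory

noncomputable section

namespace SGM

/-- The left-hand derivative `V'₋(y, a)` of `V(y, ·)` at `a`. -/
def leftDeriv (V : ℝ → ℝ → ℝ) (y a : ℝ) : ℝ :=
  derivWithin (V y) (Set.Iio a) a

section Risk

variable {X F : Type*} [MeasurableSpace X]
  [NormedAddCommGroup F] [InnerProductSpace ℝ F] {Y : Set ℝ}

/-- The expected risk `𝓔(w) = ∫ V(y, ⟨w, Φ(x)⟩) dρ(x, y)`. -/
def risk (V : ℝ → ℝ → ℝ) (Φ : X → F) (ρ : Measure (X × Y)) (w : F) : ℝ :=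
  ∫ p, V (p.2 : ℝ) (inner ℝ w (Φ p.1)) ∂ρ

/-- The excess risk `𝓔(w) - inf 𝓔`. -/
def excessRisk (V : ℝ → ℝ → ℝ) (Φ : X → F) (ρ : Measure (X × Y)) (w : F) : ℝ :=
  risk V Φ ρ w - ⨅ w' : F, risk V Φ ρ w'

/-- The approximation error `𝓓(l) = inf_w {𝓔(w) + (l / 2) ‖w‖²} - inf_w 𝓔(w)`. -/
def approxError (V : ℝ → ℝ → ℝ) (Φ : X → F) (ρ : Measure (X × Y)) (l : ℝ) : ℝ :=
  (⨅ w : F, (risk V Φ ρ w + l / 2 * ‖w‖ ^ 2)) - ⨅ w : F, risk V Φ ρ w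

/-- The approximation error decays polynomially, with exponent `β ∈ (0, 1]` and constant `c`. -/
def ApproxErrorDecay (V : ℝ → ℝ → ℝ) (Φ : X → F) (ρ : Measure (X × Y)) (β c : ℝ) : Prop :=
  0 < β ∧ β ≤ 1 ∧ 0 < c ∧ ∀ l : ℝ, 0 < l → approxError V Φ ρ l ≤ c * l ^ β

/-- `V : ℝ × ℝ → ℝ₊` is a measurable loss function, convex in its second entry for every
label in `Y`. -/
structure IsConvexLoss (Y : Set ℝ) (V : ℝ → ℝ → ℝ) : Prop where
  measurable : Measurable (Function.uncurry V)
  nonneg : ∀ y a, 0 ≤ V y a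
  convex : ∀ y ∈ Y, ConvexOn ℝ Set.univ (V y)

/-- The boundedness assumption: `sup_x ‖Φ(x)‖ ≤ κ`, `sup_{y ∈ Y} V(y, 0) ≤ V₀`, and the
left-hand derivative of the loss is bounded by `a₀`. -/
structure IsBounded (Y : Set ℝ) (V : ℝ → ℝ → ℝ) (Φ : X → F) (κ a₀ V₀ : ℝ) : Prop where
  feature : ∀ x, ‖Φ x‖ ≤ κ
  loss_zero : ∀ y ∈ Y, V y 0 ≤ V₀
  deriv : ∀ y ∈ Y, ∀ a, |leftDeriv V y a| ≤ a₀

end Risk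

section Algorithm

variable {X F : Type*} [NormedAddCommGroup F] [InnerProductSpace ℝ F] {Y : Set ℝ} {m : ℕ}

/-- The SGM iterates, indexed from `1`: `w₁ = 0` and
`w_{t+1} = w_t - η_t V'₋(y_{j_t}, ⟨w_t, Φ(x_{j_t})⟩) Φ(x_{j_t})` for `t ≥ 1`, where `z` is the
sample and `j` the sequence of selected indices.  The value at `0` is a placeholder. -/
def iterate (V : ℝ → ℝ → ℝ) (Φ : X → F) (η : ℕ → ℝ) (z : Fin m → X × Y) (j : ℕ → Fin m) :
    ℕ → F
  | 0 => 0
  | 1 => 0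
  | t + 2 =>
    let w := iterate V Φ η z j (t + 1)
    let p := z (j (t + 1))
    w - (η (t + 1) * leftDeriv V (p.2 : ℝ) (inner ℝ w (Φ p.1))) • Φ p.1

/-- The weighted averages `(∑_{k=1}^t η_k w_k) / ∑_{k=1}^t η_k` of the SGM iterates. -/
def average (V : ℝ → ℝ → ℝ) (Φ : X → F) (η : ℕ → ℝ) (z : Fin m → X × Y) (j : ℕ → Fin m)
    (t : ℕ) : F :=
  (∑ k ∈ Finset.Icc 1 t, η k)⁻¹ • ∑ k ∈ Finset.Icc 1 t, η k • iterate V Φ η z j k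

end Algorithm

/-- The law of a sample of `m` independent points drawn from `ρ`. -/
def sampleLaw {Z : Type*} [MeasurableSpace Z] (m : ℕ) (ρ : Measure Z) : Measure (Fin m → Z) :=
  Measure.pi fun _ => ρ

/-- The law of a sequence of i.i.d. indices, uniformly distributed over the sample points. -/
def indexLaw (m : ℕ) [NeZero m] : Measure (ℕ → Fin m) :=
  Measure.infinitePi fun _ => (PMF.uniformOfFintype (Fin m)).toMeasure

/-- The expected excess risk of the output `g z j` is well defined and at most `B`.  The
expectation is over the indices `j` given the sample `z` first, and then over `z`. -/
def ExpectedExcessRiskLE {X F : Type*} [MeasurableSpace X] [NormedAddCommGroup F]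
    [InnerProductSpace ℝ F] {Y : Set ℝ} {m : ℕ} [NeZero m] (V : ℝ → ℝ → ℝ) (Φ : X → F)
    (ρ : Measure (X × Y)) (g : (Fin m → X × Y) → (ℕ → Fin m) → F) (B : ℝ) : Prop :=
  Integrable (fun q : (Fin m → X × Y) × (ℕ → Fin m) => excessRisk V Φ ρ (g q.1 q.2))
      ((sampleLaw m ρ).prod (indexLaw m)) ∧
    ∫ z, ∫ j, excessRisk V Φ ρ (g z j) ∂(indexLaw m) ∂(sampleLaw m ρ) ≤ B

end SGM

end

/-! The expected excess risk splits into a generalization gap, an optimization error and an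
approximation error, and all three are controlled without a minimizer of either risk.

Optimization. With the sample fixed, expanding `‖w_{k+1} - u‖²` and using the subgradient inequality
gives a one-step recursion. The index `j_k` is uniform and independent of `w_k`, so averaging over
it turns the sampled loss into the empirical risk, and summation gives the regret inequality
`sum_mul_meanEmpRisk_sub_le`. Its comparator may depend on past indices. A fixed `u` handles the
weighted average by convexity; the comparators `w_s` with `s ≤ t`, for which the initial distance is
zero, pass from the average to the last iterate (`last_le_weighted_average`). Both outputs then have
expected empirical risk at most that of `u`, plus `‖u‖² / (2√t)`, plus a term of order `log t / √t`.

Generalization. The same recursion with `u = 0` confines the outputs to a ball of deterministic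
radius of order `t^(1/4)`. For fixed indices the output is a measurable function of the sample with
values in this ball, so symmetrization and contraction bound its expected gap by a multiple of
radius `/ √m`. Both are stated for selections instead of suprema, which avoids measurability of
suprema over the ball.

Combination. Averaging over the sample replaces the empirical risk of the fixed `u` by its risk. The
infimum over `u` is then the regularized risk with parameter `1/√t`, so the decay hypothesis
contributes `t^(-β/2)`. -/

open MeasureTheory

noncomputable section

namespace SGM

/-! ### Subgradients and measurability of the left derivative -/

section Loss

variable {Y : Set ℝ} {V : ℝ → ℝ → ℝ}

/-- The left-hand derivative of a convex loss is a subgradient. -/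
lemma IsConvexLoss.add_leftDeriv_mul_le (hV : IsConvexLoss Y V) {y : ℝ} (hy : y ∈ Y) (a b : ℝ) :
    V y a + leftDeriv V y a * (b - a) ≤ V y b := by
  have hc := hV.convex y hy
  have hi (x : ℝ) : x ∈ interior (Set.univ : Set ℝ) := by simp
  unfold leftDeriv
  rcases lt_trichotomy a b with h | rfl | h
  · have h1 := (hc.leftDeriv_le_rightDeriv_of_mem_interior (hi a)).trans
      (hc.rightDeriv_le_slope_of_mem_interior (hi a) (Set.mem_univ b) h)
    rw [slope_def_field, le_div_iff₀ (sub_pos.2 h)] at h1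
    linarith
  · simp
  · have h1 := hc.slope_le_leftDeriv_of_mem_interior (Set.mem_univ b) (hi a) h
    rw [slope_def_field, div_le_iff₀ (sub_pos.2 h)] at h1
    linarith

lemma IsConvexLoss.abs_sub_le (hV : IsConvexLoss Y V) {y a₀ : ℝ} (hy : y ∈ Y)
    (hd : ∀ a, |leftDeriv V y a| ≤ a₀) (a b : ℝ) : |V y a - V y b| ≤ a₀ * |a - b| := by
  have key (a b : ℝ) : V y a - V y b ≤ a₀ * |a - b| := by
    have h1 := hV.add_leftDeriv_mul_le hy a b
    have h2 : leftDeriv V y a * (a - b) ≤ a₀ * |a - b| :=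
      (le_abs_self _).trans (by rw [abs_mul]; exact mul_le_mul_of_nonneg_right (hd a) (abs_nonneg _))
    linarith
  exact abs_le.2 ⟨by have := key b a; rw [abs_sub_comm] at this; linarith, key a b⟩

lemma IsConvexLoss.tendsto_leftDeriv (hV : IsConvexLoss Y V) {y : ℝ} (hy : y ∈ Y) (a : ℝ) :
    Filter.Tendsto (fun n : ℕ => ((n : ℝ) + 1) * (V y a - V y (a - 1 / ((n : ℝ) + 1))))
      Filter.atTop (nhds (leftDeriv V y a)) := by
  have h := (hV.convex y hy).hasDerivWithinAt_leftDeriv_of_mem_interior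
    (show a ∈ interior (Set.univ : Set ℝ) by simp)
  rw [hasDerivWithinAt_iff_tendsto_slope' (by simp)] at h
  have hu : Filter.Tendsto (fun n : ℕ => a - 1 / ((n : ℝ) + 1)) Filter.atTop
      (nhdsWithin a (Set.Iio a)) := by
    refine tendsto_nhdsWithin_iff.2 ⟨?_, Filter.Eventually.of_forall fun n => ?_⟩
    · simpa using tendsto_one_div_add_atTop_nhds_zero_nat.const_sub a
    · have : (0 : ℝ) < 1 / ((n : ℝ) + 1) := by positivity
      simpa using this
  refine (h.comp hu).congr fun n => ?_
  have : ((n : ℝ) + 1) ≠ 0 := by positivity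
  simp only [Function.comp_apply, slope_def_field]
  field_simp
  ring

/-- A pointwise limit of measurable difference quotients is measurable. Labels are restricted to `Y`
because convexity, hence convergence of the quotients, is only assumed there. -/
lemma IsConvexLoss.measurable_leftDeriv (hV : IsConvexLoss Y V) :
    Measurable fun q : Y × ℝ => leftDeriv V (q.1 : ℝ) q.2 := by
  refine measurable_of_tendsto_metrizable (f := fun (n : ℕ) (q : Y × ℝ) =>
    ((n : ℝ) + 1) * (V q.1 q.2 - V q.1 (q.2 - 1 / ((n : ℝ) + 1)))) (fun n => ?_) ?_
  · have h1 : Measurable fun q : Y × ℝ => Function.uncurry V ((q.1 : ℝ), q.2) :=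
      hV.measurable.comp (by fun_prop)
    have h2 : Measurable fun q : Y × ℝ =>
        Function.uncurry V ((q.1 : ℝ), q.2 - 1 / ((n : ℝ) + 1)) :=
      hV.measurable.comp (by fun_prop)
    exact (h1.sub h2).const_mul _
  · exact tendsto_pi_nhds.2 fun q => hV.tendsto_leftDeriv q.1.2 q.2

end Loss

/-! ### Rademacher sums and the contraction principle -/

section Contraction

/-- The sign attached to a boolean. -/
def boolSign (b : Bool) : ℝ := cond b 1 (-1)

lemma boolSign_not (b : Bool) : boolSign (!b) = -boolSign b := by cases b <;> simp [boolSign]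

lemma boolSign_mul_self (b : Bool) : boolSign b * boolSign b = 1 := by
  cases b <;> simp [boolSign]

variable {ι : Type*} [DecidableEq ι]

/-- Flip one coordinate of a sign vector. -/
def flipAt (k : ι) (s : ι → Bool) : ι → Bool := Function.update s k (!s k)

lemma flipAt_involutive (k : ι) : Function.Involutive (flipAt k) := by
  intro s
  ext i
  by_cases h : i = k
  · subst h; simp [flipAt]
  · simp [flipAt, h]

@[simp] lemma flipAt_self (k : ι) (s : ι → Bool) : flipAt k s k = !s k := by simp [flipAt]

lemma flipAt_of_ne {k i : ι} (h : i ≠ k) (s : ι → Bool) : flipAt k s i = s i := by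
  simp [flipAt, h]

variable [Fintype ι]

lemma sum_flipAt (k : ι) (h : (ι → Bool) → ℝ) : ∑ s, h (flipAt k s) = ∑ s, h s :=
  (flipAt_involutive k).bijective.sum_comp h

/-- One step of the contraction principle, for selections instead of suprema. -/
lemma exists_selection_contraction_step {W : Type*} (S : Set W) (k : ι) (φ ψ : W → ℝ)
    (hφ : ∀ u v, |φ u - φ v| ≤ |ψ u - ψ v|) (G : (ι → Bool) → W → ℝ)
    (hG : ∀ s v, G (flipAt k s) v = G s v) (w : (ι → Bool) → W) (hw : ∀ s, w s ∈ S) :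
    ∃ u : (ι → Bool) → W, (∀ s, u s ∈ S) ∧
      ∑ s, (boolSign (s k) * φ (w s) + G s (w s)) ≤
        ∑ s, (boolSign (s k) * ψ (u s) + G s (u s)) := by
  classical
  -- Pair `s` with its flip. The selection `u` exchanges the two chosen points exactly when this
  -- makes the signed `ψ`-difference nonnegative, so that it equals the absolute value dominating
  -- the `φ`-difference. Since `G` ignores the flip, the exchange leaves its total over the pair
  -- unchanged.
  let P : (ι → Bool) → Prop := fun s =>
    0 ≤ boolSign (s k) * (ψ (w s) - ψ (w (flipAt k s)))
  let u : (ι → Bool) → W := fun s => if P s then w s else w (flipAt k s)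
  have hP (s) : P (flipAt k s) ↔ P s := by
    simp only [P, flipAt_self, boolSign_not, flipAt_involutive k s]
    constructor <;> intro h <;> linarith
  refine ⟨u, fun s => by by_cases h : P s <;> simp [u, h, hw], ?_⟩
  set A : (ι → Bool) → ℝ := fun s => boolSign (s k) * φ (w s) + G s (w s)
  set B : (ι → Bool) → ℝ := fun s => boolSign (s k) * ψ (u s) + G s (u s)
  have key : ∀ s, A s + A (flipAt k s) ≤ B s + B (flipAt k s) := by
    intro s
    have h0 := hφ (w s) (w (flipAt k s))
    simp only [A, B, flipAt_self, boolSign_not, hG, u, hP, flipAt_involutive k s]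
    by_cases h : P s
    · simp only [h, if_true]
      simp only [P] at h
      rcases hs : s k <;> simp only [hs, boolSign, cond] at h ⊢ <;>
        grind [abs_le, abs_of_nonneg, abs_of_nonpos]
    · simp only [h, if_false]
      simp only [P, not_le] at h
      rcases hs : s k <;> simp only [hs, boolSign, cond] at h ⊢ <;>
        grind [abs_le, abs_of_nonneg, abs_of_nonpos]
  have hsum : ∑ s, A s + ∑ s, A (flipAt k s) ≤ ∑ s, B s + ∑ s, B (flipAt k s) := by
    simpa only [← Finset.sum_add_distrib] using Finset.sum_le_sum fun s _ => key s
  rw [sum_flipAt k A, sum_flipAt k B] at hsum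
  linarith

/-- The contraction principle, for selections instead of suprema. -/
lemma exists_selection_contraction {W : Type*} (S : Set W) (φ ψ : ι → W → ℝ)
    (hφ : ∀ i u v, |φ i u - φ i v| ≤ |ψ i u - ψ i v|)
    (w : (ι → Bool) → W) (hw : ∀ s, w s ∈ S) :
    ∃ u : (ι → Bool) → W, (∀ s, u s ∈ S) ∧
      ∑ s, ∑ i, boolSign (s i) * φ i (w s) ≤ ∑ s, ∑ i, boolSign (s i) * ψ i (u s) := by
  -- `φ` is replaced by `ψ` one coordinate at a time; `T` collects the coordinates already replaced,
  -- and the selection may change at each stage.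
  suffices H : ∀ T : Finset ι, ∃ u : (ι → Bool) → W, (∀ s, u s ∈ S) ∧
      ∑ s, ∑ i, boolSign (s i) * φ i (w s) ≤
        ∑ s, ∑ i, boolSign (s i) * (if i ∈ T then ψ i (u s) else φ i (u s)) by
    simpa using H Finset.univ
  intro T
  induction T using Finset.induction_on with
  | empty => exact ⟨w, hw, by simp⟩
  | insert k T hk ih =>
    obtain ⟨u, hu, h⟩ := ih
    obtain ⟨v, hv, h'⟩ := exists_selection_contraction_step S k (φ k) (ψ k) (hφ k)
      (fun s x => ∑ i ∈ Finset.univ.erase k,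
        boolSign (s i) * (if i ∈ T then ψ i x else φ i x))
      (fun s x => Finset.sum_congr rfl fun i hi => by
        rw [flipAt_of_ne (Finset.ne_of_mem_erase hi)]) u hu
    refine ⟨v, hv, h.trans (le_of_eq_of_le ?_ (h'.trans_eq ?_))⟩
    · refine Finset.sum_congr rfl fun s _ => ?_
      rw [← Finset.add_sum_erase _ _ (Finset.mem_univ k)]
      simp [hk]
    · refine Finset.sum_congr rfl fun s _ => ?_
      rw [← Finset.add_sum_erase _ _ (Finset.mem_univ k)]
      simp only [Finset.mem_insert, true_or, if_true]
      congr 1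
      refine Finset.sum_congr rfl fun i hi => ?_
      simp [Finset.ne_of_mem_erase hi]

lemma sum_boolSign_mul_boolSign (i k : ι) :
    ∑ s : ι → Bool, boolSign (s i) * boolSign (s k) =
      if i = k then (2 : ℝ) ^ Fintype.card ι else 0 := by
  split_ifs with h
  · subst h
    simp [boolSign_mul_self]
  · have h1 := sum_flipAt k fun s : ι → Bool => boolSign (s i) * boolSign (s k)
    simp only [flipAt_self, boolSign_not, flipAt_of_ne h, mul_neg, Finset.sum_neg_distrib] at h1
    linarith

variable {F : Type*} [NormedAddCommGroup F] [InnerProductSpace ℝ F]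

lemma sum_norm_sq_sum_boolSign_smul (v : ι → F) :
    ∑ s : ι → Bool, ‖∑ i, boolSign (s i) • v i‖ ^ 2 =
      2 ^ Fintype.card ι * ∑ i, ‖v i‖ ^ 2 := by
  have h (s : ι → Bool) : ‖∑ i, boolSign (s i) • v i‖ ^ 2 =
      ∑ i, ∑ k, boolSign (s i) * boolSign (s k) * inner ℝ (v i) (v k) := by
    rw [← real_inner_self_eq_norm_sq, sum_inner]
    refine Finset.sum_congr rfl fun i _ => ?_
    rw [inner_sum]
    refine Finset.sum_congr rfl fun k _ => ?_
    rw [real_inner_smul_left, real_inner_smul_right]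
    ring
  simp_rw [h]
  rw [Finset.sum_comm, Finset.mul_sum]
  refine Finset.sum_congr rfl fun i _ => ?_
  rw [Finset.sum_comm]
  simp_rw [← Finset.sum_mul, sum_boolSign_mul_boolSign]
  simp

/-- Cauchy–Schwarz over the sign vectors reduces to second moments, where orthogonality of distinct
signs removes the cross terms. The absolute value of `κ` covers empty `ι`, where `κ` may be
negative. -/
lemma sum_norm_sum_boolSign_smul_le (v : ι → F) {κ : ℝ} (hv : ∀ i, ‖v i‖ ≤ κ) :
    ∑ s : ι → Bool, ‖∑ i, boolSign (s i) • v i‖ ≤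
      2 ^ Fintype.card ι * (|κ| * √(Fintype.card ι)) := by
  have h1 := sq_sum_le_card_mul_sum_sq (s := Finset.univ)
    (f := fun s : ι → Bool => ‖∑ i, boolSign (s i) • v i‖)
  rw [sum_norm_sq_sum_boolSign_smul] at h1
  have h2 : ∑ i, ‖v i‖ ^ 2 ≤ Fintype.card ι * κ ^ 2 := by
    refine (Finset.sum_le_card_nsmul _ _ (κ ^ 2) fun i _ => ?_).trans (by simp)
    exact pow_le_pow_left₀ (norm_nonneg _) (hv i) 2
  refine abs_le_of_sq_le_sq' ?_ (by positivity) |>.2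
  refine h1.trans ?_
  have hs : √(Fintype.card ι : ℝ) ^ 2 = Fintype.card ι := Real.sq_sqrt (by positivity)
  have hc : ((Finset.univ : Finset (ι → Bool)).card : ℝ) = 2 ^ Fintype.card ι := by simp
  rw [hc, mul_pow, mul_pow, hs, sq_abs, ← mul_assoc, ← sq]
  gcongr
  linarith

/-- The Rademacher complexity of Lipschitz functions of bounded linear functionals, for selections
instead of suprema. -/
lemma sum_boolSign_mul_le (φ : ι → ℝ → ℝ) (v : ι → F) {a₀ κ R : ℝ} (ha : 0 ≤ a₀)
    (hφ : ∀ i a b, |φ i a - φ i b| ≤ a₀ * |a - b|) (hv : ∀ i, ‖v i‖ ≤ κ)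
    (w : (ι → Bool) → F) (hw : ∀ s, ‖w s‖ ≤ R) :
    ∑ s, ∑ i, boolSign (s i) * φ i (inner ℝ (w s) (v i)) ≤
      2 ^ Fintype.card ι * (a₀ * R * |κ| * √(Fintype.card ι)) := by
  obtain ⟨u, hu, h⟩ := exists_selection_contraction {x : F | ‖x‖ ≤ R}
    (fun i x => φ i (inner ℝ x (v i))) (fun i x => a₀ * inner ℝ x (v i))
    (fun i x y => by
      rw [← mul_sub, abs_mul, abs_of_nonneg ha]
      exact hφ i _ _) w hw
  have hR : 0 ≤ R := (norm_nonneg _).trans (hw fun _ => true)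
  refine h.trans ?_
  have h1 (s : ι → Bool) : ∑ i, boolSign (s i) * (a₀ * inner ℝ (u s) (v i)) ≤
      a₀ * R * ‖∑ i, boolSign (s i) • v i‖ := by
    have : ∑ i, boolSign (s i) * (a₀ * inner ℝ (u s) (v i)) =
        a₀ * inner ℝ (u s) (∑ i, boolSign (s i) • v i) := by
      rw [inner_sum, Finset.mul_sum]
      refine Finset.sum_congr rfl fun i _ => ?_
      rw [real_inner_smul_right]
      ring
    rw [this, mul_assoc]
    refine mul_le_mul_of_nonneg_left ((real_inner_le_norm _ _).trans ?_) ha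
    exact mul_le_mul_of_nonneg_right (hu s) (norm_nonneg _)
  refine (Finset.sum_le_sum fun s _ => h1 s).trans ?_
  rw [← Finset.mul_sum]
  refine (mul_le_mul_of_nonneg_left (sum_norm_sum_boolSign_smul_le v hv)
    (by positivity)).trans_eq ?_
  ring

end Contraction

/-! ### Symmetrization with a ghost sample -/

section Symmetrization

variable {Z : Type*} [MeasurableSpace Z] {m : ℕ}

/-- Swap the two entries of the pairs selected by a boolean vector. -/
def swapPairs (s : Fin m → Bool) (p : Fin m → Z × Z) : Fin m → Z × Z :=
  fun i => cond (s i) (p i) (p i).swap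

lemma measurePreserving_swapPairs (ρ : Measure Z) [IsProbabilityMeasure ρ] (s : Fin m → Bool) :
    MeasurePreserving (swapPairs s) (Measure.pi fun _ : Fin m => ρ.prod ρ)
      (Measure.pi fun _ => ρ.prod ρ) := by
  refine measurePreserving_pi (f := fun i (q : Z × Z) => cond (s i) q q.swap) _ _ fun i => ?_
  cases s i
  · exact Measure.measurePreserving_swap
  · exact MeasurePreserving.id _

lemma integral_prod_sampleLaw (ρ : Measure Z) [IsProbabilityMeasure ρ]
    (G : (Fin m → Z) × (Fin m → Z) → ℝ) :
    ∫ q, G q ∂((sampleLaw m ρ).prod (sampleLaw m ρ)) =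
      ∫ p : Fin m → Z × Z, G (fun i => (p i).1, fun i => (p i).2)
        ∂(Measure.pi fun _ => ρ.prod ρ) :=
  ((measurePreserving_arrowProdEquivProdArrow Z Z (Fin m) (fun _ => ρ)
    (fun _ => ρ)).integral_comp' G).symm

instance (ρ : Measure Z) [IsProbabilityMeasure ρ] : IsProbabilityMeasure (sampleLaw m ρ) := by
  unfold sampleLaw; infer_instance

lemma integral_sampleLaw_eval (ρ : Measure Z) [IsProbabilityMeasure ρ] (i : Fin m) {h : Z → ℝ}
    (hh : Measurable h) : ∫ z, h (z i) ∂(sampleLaw m ρ) = ∫ p, h p ∂ρ := by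
  have hm : MeasurePreserving (fun z : Fin m → Z => z i) (sampleLaw m ρ) ρ :=
    measurePreserving_eval (fun _ : Fin m => ρ) i
  rw [← hm.map_eq, integral_map hm.measurable.aemeasurable hh.aestronglyMeasurable, hm.map_eq]

lemma integrable_of_measurable_of_abs_le {Ω : Type*} [MeasurableSpace Ω] {μ : Measure Ω}
    [IsFiniteMeasure μ] {h : Ω → ℝ} (hh : Measurable h) {B : ℝ} (hB : ∀ x, |h x| ≤ B) :
    Integrable h μ :=
  Integrable.of_bound hh.aestronglyMeasurable B (Filter.Eventually.of_forall hB)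

/-- Symmetrization for a measurable selection `g`: the generalization gap of `g` is bounded by
twice the Rademacher complexity of the set where `g` takes its values. -/
lemma integral_sum_gap_le {F : Type*} [MeasurableSpace F] (ρ : Measure Z)
    [IsProbabilityMeasure ρ] (f : F → Z → ℝ) (hf : Measurable (Function.uncurry f)) (S : Set F)
    {B D : ℝ} (hB : ∀ w ∈ S, ∀ p, |f w p| ≤ B)
    (hD : ∀ (z : Fin m → Z) (w : (Fin m → Bool) → F), (∀ s, w s ∈ S) →
      ∑ s, ∑ i, boolSign (s i) * f (w s) (z i) ≤ 2 ^ m * D)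
    (g : (Fin m → Z) → F) (hg : Measurable g) (hgS : ∀ z, g z ∈ S) :
    ∫ z, ∑ i, (∫ p, f (g z) p ∂ρ - f (g z) (z i)) ∂(sampleLaw m ρ) ≤ 2 * D := by
  -- The second sample is a ghost: integrating it out turns its losses into the expected loss of `g`
  -- on the first sample.
  set K : (Fin m → Z) × (Fin m → Z) → ℝ := fun q =>
    ∑ i, (f (g q.1) (q.2 i) - f (g q.1) (q.1 i)) with hK
  have hfm {α : Type _} [MeasurableSpace α] {a : α → F} {b : α → Z} (ha : Measurable a)
      (hb : Measurable b) : Measurable fun x => f (a x) (b x) := hf.comp (ha.prodMk hb)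
  have hKm : Measurable K := Finset.measurable_fun_sum _ fun i _ =>
    (hfm (hg.comp measurable_fst) ((measurable_pi_apply i).comp measurable_snd)).sub
      (hfm (hg.comp measurable_fst) ((measurable_pi_apply i).comp measurable_fst))
  have hKB (q) : |K q| ≤ m * (2 * B) := by
    refine (Finset.abs_sum_le_sum_abs _ _).trans ?_
    refine (Finset.sum_le_card_nsmul _ _ (2 * B) fun i _ => ?_).trans (by simp)
    have h1 := hB _ (hgS q.1) (q.2 i)
    have h2 := hB _ (hgS q.1) (q.1 i)
    rw [abs_le] at *
    constructor <;> linarith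
  have e1 : ∫ z, ∑ i, (∫ p, f (g z) p ∂ρ - f (g z) (z i)) ∂(sampleLaw m ρ) =
      ∫ q, K q ∂((sampleLaw m ρ).prod (sampleLaw m ρ)) := by
    rw [integral_prod _ (integrable_of_measurable_of_abs_le hKm hKB)]
    refine integral_congr_ae (Filter.Eventually.of_forall fun z => ?_)
    simp only [hK]
    rw [integral_finsetSum]
    · refine Finset.sum_congr rfl fun i _ => ?_
      rw [integral_sub _ (integrable_const _)]
      · rw [integral_sampleLaw_eval ρ i (h := f (g z)) (hfm measurable_const measurable_id)]
        simp
      · exact integrable_of_measurable_of_abs_le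
          (hfm measurable_const (measurable_pi_apply i)) fun z' => hB _ (hgS z) _
    · intro i _
      exact (integrable_of_measurable_of_abs_le
          (hfm measurable_const (measurable_pi_apply i)) fun z' => hB _ (hgS z) _).sub
        (integrable_const _)
  rw [e1, integral_prod_sampleLaw]
  set K' : (Fin m → Z × Z) → ℝ := fun p => K (fun i => (p i).1, fun i => (p i).2)
  have hK'm : Measurable K' := hKm.comp (by fun_prop)
  have e2 (s : Fin m → Bool) : ∫ p, K' (swapPairs s p) ∂(Measure.pi fun _ => ρ.prod ρ) =
      ∫ p, K' p ∂(Measure.pi fun _ => ρ.prod ρ) := by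
    have h := measurePreserving_swapPairs ρ s
    conv_rhs => rw [← h.map_eq]
    rw [integral_map h.measurable.aemeasurable hK'm.aestronglyMeasurable]
  -- Swapping pairs changes the sample fed to `g`, so the chosen point depends on the signs in an
  -- arbitrary way; this is why `hD` must hold for every selection. The two halves of each pair give
  -- one Rademacher sum each, the one with negative signs being reduced to `hD` by complementing all
  -- signs.
  have hpt (p : Fin m → Z × Z) : ∑ s, K' (swapPairs s p) ≤ 2 ^ m * (2 * D) := by
    have hw (s : Fin m → Bool) := hgS fun i => (swapPairs s p i).1
    have h1 := hD (fun i => (p i).2) _ hw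
    have h2 := hD (fun i => (p i).1) (fun s => g fun i => (swapPairs (fun k => !s k) p i).1)
      fun s => hw _
    have h3 : ∑ s : Fin m → Bool, ∑ i, boolSign (s i) *
        f (g fun i => (swapPairs (fun k => !s k) p i).1) (p i).1 =
        ∑ s : Fin m → Bool, ∑ i, -(boolSign (s i) * f (g fun i => (swapPairs s p i).1) (p i).1) := by
      have hinv : Function.Involutive fun (s : Fin m → Bool) k => !s k := fun s => by simp
      rw [← hinv.bijective.sum_comp]
      simp [boolSign_not]
    rw [h3] at h2
    have h4 : ∑ s, K' (swapPairs s p) = ∑ s : Fin m → Bool, ∑ i,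
        boolSign (s i) * f (g fun i => (swapPairs s p i).1) (p i).2 +
        ∑ s : Fin m → Bool, ∑ i, -(boolSign (s i) * f (g fun i => (swapPairs s p i).1) (p i).1) := by
      rw [← Finset.sum_add_distrib]
      refine Finset.sum_congr rfl fun s _ => ?_
      rw [← Finset.sum_add_distrib]
      refine Finset.sum_congr rfl fun i _ => ?_
      have hK' : f (g fun i => (swapPairs s p i).1) (swapPairs s p i).2 -
          f (g fun i => (swapPairs s p i).1) (swapPairs s p i).1 =
          boolSign (s i) * f (g fun i => (swapPairs s p i).1) (p i).2 +
          -(boolSign (s i) * f (g fun i => (swapPairs s p i).1) (p i).1) := by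
        generalize (g fun i => (swapPairs s p i).1) = v
        rcases hs : s i <;> simp [swapPairs, hs, boolSign] <;> ring
      exact hK'
    rw [h4]
    linarith
  have hint (s : Fin m → Bool) : Integrable (fun p => K' (swapPairs s p))
      (Measure.pi fun _ : Fin m => ρ.prod ρ) :=
    integrable_of_measurable_of_abs_le
      (hK'm.comp (measurePreserving_swapPairs ρ s).measurable) fun p => hKB _
  have h5 : ∫ p, ∑ s, K' (swapPairs s p) ∂(Measure.pi fun _ : Fin m => ρ.prod ρ) ≤
      2 ^ m * (2 * D) := by
    refine (integral_mono (integrable_finsetSum _ fun s _ => hint s) (integrable_const _)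
      hpt).trans_eq (by simp)
  rw [integral_finsetSum _ fun s _ => hint s, Finset.sum_congr rfl fun s _ => e2 s] at h5
  simp only [Finset.sum_const, Finset.card_univ, Fintype.card_pi, Fintype.card_bool,
    Finset.prod_const, Fintype.card_fin, nsmul_eq_mul, Nat.cast_pow, Nat.cast_ofNat] at h5
  exact le_of_mul_le_mul_left h5 (by positivity)

end Symmetrization

/-! ### Uniformity of an index given the others -/

section Shift

variable {m : ℕ} [NeZero m]

/-- Add `i` to the `t`-th entry of a sequence of indices. -/
def shiftIndex (t : ℕ) (i : Fin m) (j : ℕ → Fin m) : ℕ → Fin m :=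
  fun k => if k = t then j k + i else j k

instance : IsProbabilityMeasure (indexLaw m) := by unfold indexLaw; infer_instance

/-- Translation in `Fin m` preserves the uniform law. Invariance under shifting one coordinate
replaces conditional expectations in what follows. -/
lemma measurePreserving_shiftIndex (t : ℕ) (i : Fin m) :
    MeasurePreserving (shiftIndex t i) (indexLaw m) (indexLaw m) := by
  have hf (k : ℕ) : Measurable fun a : Fin m => if k = t then a + i else a :=
    measurable_of_finite _
  refine ⟨measurable_pi_iff.2 fun k => (hf k).comp (measurable_pi_apply k), ?_⟩
  refine (Measure.infinitePi_map_pi _ hf).trans ?_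
  unfold indexLaw
  congr 1
  funext k
  split_ifs with h
  · refine Measure.ext_of_singleton fun a => ?_
    have hpre : (fun b : Fin m => b + i) ⁻¹' {a} = {a - i} := by
      ext b; exact eq_sub_iff_add_eq.symm
    rw [Measure.map_apply (measurable_of_finite _) (measurableSet_singleton a), hpre]
    simp
  · exact Measure.map_id

/-- Conditional on the indices that `U` depends on, the `t`-th index is uniform. -/
lemma integral_indexLaw_eval {W : Type*} [MeasurableSpace W] (t : ℕ) (U : (ℕ → Fin m) → W)
    (hU : Measurable U) (hUt : ∀ i j, U (shiftIndex t i j) = U j) (h : Fin m → W → ℝ)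
    (hh : ∀ i, Measurable (h i)) {B : ℝ} (hB : ∀ i j, |h i (U j)| ≤ B) :
    ∫ j, h (j t) (U j) ∂(indexLaw m) = ∫ j, (m : ℝ)⁻¹ * ∑ i, h i (U j) ∂(indexLaw m) := by
  have hm : Measurable fun j : ℕ → Fin m => h (j t) (U j) :=
    (measurable_from_prod_countable_right (f := fun q : Fin m × W => h q.1 q.2) hh).comp
      ((measurable_pi_apply t).prodMk hU)
  have e (i : Fin m) : ∫ j, h (j t + i) (U j) ∂(indexLaw m) =
      ∫ j, h (j t) (U j) ∂(indexLaw m) := by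
    have hs := measurePreserving_shiftIndex t i
    conv_rhs => rw [← hs.map_eq]
    rw [integral_map hs.measurable.aemeasurable hm.aestronglyMeasurable]
    simp [hUt, shiftIndex]
  have hint (i : Fin m) : Integrable (fun j => h (j t + i) (U j)) (indexLaw m) := by
    refine integrable_of_measurable_of_abs_le ?_ fun j => hB _ j
    exact (measurable_from_prod_countable_right (f := fun q : Fin m × W => h (q.1 + i) q.2)
      fun a => hh _).comp ((measurable_pi_apply t).prodMk hU)
  -- For each `j`, reindex the sum over sample points by `i ↦ j t + i`; each summand is then a shift
  -- of the left-hand integrand and has the same integral.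
  have e2 : ∀ j : ℕ → Fin m, ∑ i, h i (U j) = ∑ i, h (j t + i) (U j) := fun j =>
    ((Equiv.addLeft (j t)).bijective.sum_comp fun i => h i (U j)).symm
  simp_rw [e2]
  rw [integral_const_mul, integral_finsetSum _ fun i _ => hint i,
    Finset.sum_congr rfl fun i _ => e i]
  have : (m : ℝ) ≠ 0 := Nat.cast_ne_zero.2 (NeZero.ne m)
  simp [this]

end Shift

/-! ### Pointwise and empirical losses -/

section Empirical

variable {X F : Type*} [NormedAddCommGroup F] {Y : Set ℝ} {V : ℝ → ℝ → ℝ} {Φ : X → F}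
  {κ a₀ V₀ : ℝ} {m : ℕ}

lemma IsBounded.kappa_nonneg (hB : IsBounded Y V Φ κ a₀ V₀) (p : X × Y) : 0 ≤ κ :=
  (norm_nonneg _).trans (hB.feature p.1)

lemma IsBounded.lipschitz_nonneg (hB : IsBounded Y V Φ κ a₀ V₀) (p : X × Y) : 0 ≤ a₀ :=
  (abs_nonneg _).trans (hB.deriv _ p.2.2 0)

lemma loss_zero_nonneg (hV : IsConvexLoss Y V) (hB : IsBounded Y V Φ κ a₀ V₀) (p : X × Y) :
    0 ≤ V₀ := (hV.nonneg _ _).trans (hB.loss_zero _ p.2.2)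

variable [InnerProductSpace ℝ F]

/-- The loss of `w` at a point. -/
def pointLoss (V : ℝ → ℝ → ℝ) (Φ : X → F) (w : F) (p : X × Y) : ℝ :=
  V (p.2 : ℝ) (inner ℝ w (Φ p.1))

/-- The empirical risk of `w` on a sample. -/
def empRisk (V : ℝ → ℝ → ℝ) (Φ : X → F) (z : Fin m → X × Y) (w : F) : ℝ :=
  (m : ℝ)⁻¹ * ∑ i, pointLoss V Φ w (z i)

lemma pointLoss_le (hV : IsConvexLoss Y V) (hB : IsBounded Y V Φ κ a₀ V₀) (w : F)
    (p : X × Y) : pointLoss V Φ w p ≤ V₀ + a₀ * κ * ‖w‖ := by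
  have h1 := (abs_le.1 (hV.abs_sub_le p.2.2 (hB.deriv _ p.2.2) (inner ℝ w (Φ p.1)) 0)).2
  have h2 := hB.loss_zero _ p.2.2
  have h3 : |inner ℝ w (Φ p.1)| ≤ ‖w‖ * κ := (abs_real_inner_le_norm _ _).trans
    (mul_le_mul_of_nonneg_left (hB.feature _) (norm_nonneg _))
  have h4 := mul_le_mul_of_nonneg_left h3 (hB.lipschitz_nonneg p)
  rw [sub_zero] at h1
  unfold pointLoss
  linarith

lemma pointLoss_nonneg (hV : IsConvexLoss Y V) (w : F) (p : X × Y) : 0 ≤ pointLoss V Φ w p :=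
  hV.nonneg _ _

lemma abs_pointLoss_le (hV : IsConvexLoss Y V) (hB : IsBounded Y V Φ κ a₀ V₀) {w : F} {R : ℝ}
    (hw : ‖w‖ ≤ R) (p : X × Y) : |pointLoss V Φ w p| ≤ V₀ + a₀ * κ * R := by
  rw [abs_of_nonneg (pointLoss_nonneg hV _ _)]
  refine (pointLoss_le hV hB w p).trans ?_
  have := mul_nonneg (hB.lipschitz_nonneg p) (hB.kappa_nonneg p)
  gcongr

lemma measurable_pointLoss [MeasurableSpace X] [MeasurableSpace F] [BorelSpace F] [SecondCountableTopology F]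
    (hΦ : Measurable Φ) (hV : IsConvexLoss Y V) :
    Measurable (Function.uncurry fun (w : F) (p : X × Y) => pointLoss V Φ w p) := by
  refine hV.measurable.comp (f := fun q : F × X × Y =>
    ((q.2.2 : ℝ), (inner ℝ q.1 (Φ q.2.1) : ℝ))) ?_
  fun_prop

lemma convexOn_empRisk (hV : IsConvexLoss Y V) (z : Fin m → X × Y) :
    ConvexOn ℝ Set.univ (empRisk V Φ z) := by
  refine ⟨convex_univ, fun u _ v _ a b ha hb hab => ?_⟩
  unfold empRisk
  simp only [smul_eq_mul]
  rw [show ∀ A B : ℝ, a * ((m : ℝ)⁻¹ * A) + b * ((m : ℝ)⁻¹ * B) =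
    (m : ℝ)⁻¹ * (a * A + b * B) by intros; ring, Finset.mul_sum (a := a),
    Finset.mul_sum (a := b), ← Finset.sum_add_distrib]
  refine mul_le_mul_of_nonneg_left (Finset.sum_le_sum fun i _ => ?_) (by positivity)
  have := (hV.convex _ (z i).2.2).2 (Set.mem_univ (inner ℝ u (Φ (z i).1)))
    (Set.mem_univ (inner ℝ v (Φ (z i).1))) ha hb hab
  simpa [pointLoss, inner_add_left, real_inner_smul_left] using this

lemma empRisk_nonneg (hV : IsConvexLoss Y V) (z : Fin m → X × Y) (w : F) :
    0 ≤ empRisk V Φ z w :=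
  mul_nonneg (by positivity) (Finset.sum_nonneg fun _ _ => pointLoss_nonneg hV _ _)

lemma abs_empRisk_le [NeZero m] (hV : IsConvexLoss Y V) (hB : IsBounded Y V Φ κ a₀ V₀) {w : F}
    {R : ℝ} (hw : ‖w‖ ≤ R) (z : Fin m → X × Y) : |empRisk V Φ z w| ≤ V₀ + a₀ * κ * R := by
  have hm : (0 : ℝ) < m := Nat.cast_pos.2 (NeZero.pos m)
  rw [abs_of_nonneg (empRisk_nonneg hV _ _), empRisk, inv_mul_le_iff₀ hm]
  refine (Finset.sum_le_card_nsmul _ _ (V₀ + a₀ * κ * R) fun i _ => ?_).trans_eq (by simp [mul_add])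
  exact (le_abs_self _).trans (abs_pointLoss_le hV hB hw _)

lemma measurable_empRisk [MeasurableSpace X] [MeasurableSpace F] [BorelSpace F] [SecondCountableTopology F]
    (hΦ : Measurable Φ) (hV : IsConvexLoss Y V) :
    Measurable (Function.uncurry fun (z : Fin m → X × Y) (w : F) => empRisk V Φ z w) := by
  refine (Finset.measurable_fun_sum Finset.univ fun i _ => ?_).const_mul _
  exact (measurable_pointLoss hΦ hV).comp
    (measurable_snd.prodMk ((measurable_pi_apply i).comp measurable_fst))

end Empirical

/-! ### The recursion, norm bounds and the regret inequality -/

section Iterates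

variable {X F : Type*} [NormedAddCommGroup F] [InnerProductSpace ℝ F]
  {Y : Set ℝ} {V : ℝ → ℝ → ℝ} {Φ : X → F} {κ a₀ V₀ : ℝ} {m : ℕ} {η : ℕ → ℝ}

lemma iterate_one (z : Fin m → X × Y) (j : ℕ → Fin m) : iterate V Φ η z j 1 = 0 := by
  simp [iterate]

lemma iterate_succ {t : ℕ} (ht : 1 ≤ t) (z : Fin m → X × Y) (j : ℕ → Fin m) :
    iterate V Φ η z j (t + 1) = iterate V Φ η z j t -
      (η t * leftDeriv V ((z (j t)).2 : ℝ) (inner ℝ (iterate V Φ η z j t) (Φ (z (j t)).1))) •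
        Φ (z (j t)).1 := by
  obtain ⟨t, rfl⟩ := Nat.exists_eq_add_of_le' ht
  rw [iterate]

lemma iterate_congr (z : Fin m → X × Y) {j j' : ℕ → Fin m} {t : ℕ}
    (h : ∀ s < t, j s = j' s) : iterate V Φ η z j t = iterate V Φ η z j' t := by
  induction t with
  | zero => simp [iterate]
  | succ t ih =>
    rcases Nat.eq_zero_or_pos t with rfl | ht
    · simp [iterate]
    · rw [iterate_succ ht, iterate_succ ht, ih fun s hs => h s (hs.trans t.lt_succ_self),
        h t t.lt_succ_self]

/-- The step that uses index `t` produces iterate `t + 1`, so `s = t` is allowed. -/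
lemma iterate_shiftIndex [NeZero m] (z : Fin m → X × Y) (j : ℕ → Fin m) {s t : ℕ} (hst : s ≤ t)
    (i : Fin m) : iterate V Φ η z (shiftIndex t i j) s = iterate V Φ η z j s :=
  iterate_congr z fun k hk => by simp [shiftIndex, (hk.trans_le hst).ne]

/-- Expand the square: the quadratic term is bounded by `a₀ κ`, and the cross term by the
subgradient inequality at the current iterate. -/
lemma norm_iterate_succ_sub_sq_le (hV : IsConvexLoss Y V) (hB : IsBounded Y V Φ κ a₀ V₀)
    {t : ℕ} (ht : 1 ≤ t) (hη : 0 ≤ η t) (z : Fin m → X × Y) (j : ℕ → Fin m) (u : F) :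
    ‖iterate V Φ η z j (t + 1) - u‖ ^ 2 ≤ ‖iterate V Φ η z j t - u‖ ^ 2 +
      η t ^ 2 * (a₀ * κ) ^ 2 + 2 * η t *
        (pointLoss V Φ u (z (j t)) - pointLoss V Φ (iterate V Φ η z j t) (z (j t))) := by
  rw [iterate_succ ht]
  generalize iterate V Φ η z j t = w
  generalize z (j t) = p
  set d := leftDeriv V (p.2 : ℝ) (inner ℝ w (Φ p.1)) with hd
  have hsub := hV.add_leftDeriv_mul_le p.2.2 (inner ℝ w (Φ p.1)) (inner ℝ u (Φ p.1))
  rw [← hd] at hsub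
  have e : ‖w - (η t * d) • Φ p.1 - u‖ ^ 2 = ‖w - u‖ ^ 2 + η t ^ 2 * (|d| * ‖Φ p.1‖) ^ 2 +
      2 * η t * (d * (inner ℝ u (Φ p.1) - inner ℝ w (Φ p.1))) := by
    rw [sub_right_comm, norm_sub_sq_real, norm_smul, real_inner_smul_right, inner_sub_left,
      Real.norm_eq_abs, abs_mul, mul_pow, mul_pow, mul_pow, sq_abs, sq_abs]
    ring
  rw [e]
  have h1 : |d| * ‖Φ p.1‖ ≤ a₀ * κ :=
    mul_le_mul (hB.deriv _ p.2.2 _) (hB.feature _) (norm_nonneg _) (hB.lipschitz_nonneg p)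
  have h2 : (|d| * ‖Φ p.1‖) ^ 2 ≤ (a₀ * κ) ^ 2 := pow_le_pow_left₀ (by positivity) h1 2
  have h3 : d * (inner ℝ u (Φ p.1) - inner ℝ w (Φ p.1)) ≤
      pointLoss V Φ u p - pointLoss V Φ w p := by
    unfold pointLoss; linarith
  gcongr

/-- Compare with `0`, whose loss is at most `V₀`, and discard the nonnegative loss of the iterate.
As `η ≤ 1`, also `η² ≤ η`, so each step adds at most a multiple of `η`. -/
lemma norm_iterate_sq_le (hV : IsConvexLoss Y V) (hB : IsBounded Y V Φ κ a₀ V₀)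
    (hη : ∀ t, 1 ≤ t → 0 ≤ η t ∧ η t ≤ 1) (z : Fin m → X × Y) (j : ℕ → Fin m) {t : ℕ}
    (ht : 1 ≤ t) :
    ‖iterate V Φ η z j t‖ ^ 2 ≤ ((a₀ * κ) ^ 2 + 2 * V₀) * ∑ k ∈ Finset.Ico 1 t, η k := by
  induction t, ht using Nat.le_induction with
  | base => simp [iterate_one]
  | succ t ht ih =>
    have h := norm_iterate_succ_sub_sq_le hV hB ht (hη t ht).1 z j 0
    obtain ⟨h0, h1⟩ := hη t ht
    have h2 := pointLoss_nonneg (Φ := Φ) hV (iterate V Φ η z j t) (z (j t))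
    have h3 := pointLoss_le hV hB 0 (z (j t))
    rw [norm_zero, mul_zero, add_zero] at h3
    rw [sub_zero, sub_zero] at h
    rw [Finset.sum_Ico_succ_top ht, mul_add]
    have h4 : η t ^ 2 * (a₀ * κ) ^ 2 ≤ η t * (a₀ * κ) ^ 2 :=
      mul_le_mul_of_nonneg_right (by nlinarith) (sq_nonneg _)
    have h5 := mul_le_mul_of_nonneg_left (show pointLoss V Φ 0 (z (j t)) -
      pointLoss V Φ (iterate V Φ η z j t) (z (j t)) ≤ V₀ by linarith)
      (show 0 ≤ 2 * η t by linarith)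
    linarith

/-- A bound on the norm of the iterates up to time `t`. -/
def normBound (κ a₀ V₀ : ℝ) (η : ℕ → ℝ) (t : ℕ) : ℝ :=
  √(((a₀ * κ) ^ 2 + 2 * V₀) * ∑ k ∈ Finset.Ico 1 t, η k)

lemma norm_iterate_le (hV : IsConvexLoss Y V) (hB : IsBounded Y V Φ κ a₀ V₀)
    (hη : ∀ t, 1 ≤ t → 0 ≤ η t ∧ η t ≤ 1) (z : Fin m → X × Y) (j : ℕ → Fin m) {k t : ℕ}
    (hk : 1 ≤ k) (hkt : k ≤ t) : ‖iterate V Φ η z j k‖ ≤ normBound κ a₀ V₀ η t := by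
  refine Real.le_sqrt_of_sq_le ((norm_iterate_sq_le hV hB hη z j hk).trans ?_)
  have := loss_zero_nonneg hV hB (z (j 0))
  refine mul_le_mul_of_nonneg_left ?_ (by positivity)
  exact Finset.sum_le_sum_of_subset_of_nonneg (Finset.Ico_subset_Ico_right hkt)
    fun i hi _ => (hη i (Finset.mem_Ico.1 hi).1).1

lemma norm_average_le (hV : IsConvexLoss Y V) (hB : IsBounded Y V Φ κ a₀ V₀)
    (hη : ∀ t, 1 ≤ t → 0 < η t ∧ η t ≤ 1) (z : Fin m → X × Y) (j : ℕ → Fin m) {t : ℕ}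
    (ht : 1 ≤ t) : ‖average V Φ η z j t‖ ≤ normBound κ a₀ V₀ η t := by
  have hpos : 0 < ∑ k ∈ Finset.Icc 1 t, η k :=
    Finset.sum_pos (fun k hk => (hη k (Finset.mem_Icc.1 hk).1).1) ⟨1, by simp [ht]⟩
  rw [average, norm_smul, Real.norm_of_nonneg (by positivity), inv_mul_le_iff₀ hpos,
    Finset.sum_mul]
  refine (norm_sum_le _ _).trans (Finset.sum_le_sum fun k hk => ?_)
  obtain ⟨h1, h2⟩ := Finset.mem_Icc.1 hk
  rw [norm_smul, Real.norm_of_nonneg (hη k h1).1.le]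
  exact mul_le_mul_of_nonneg_left
    (norm_iterate_le hV hB (fun t ht => ⟨(hη t ht).1.le, (hη t ht).2⟩) z j h1 h2) (hη k h1).1.le

variable [MeasurableSpace X] [MeasurableSpace F] [BorelSpace F] [SecondCountableTopology F]

lemma measurable_iterate (hΦ : Measurable Φ) (hV : IsConvexLoss Y V) (t : ℕ) :
    Measurable fun q : (Fin m → X × Y) × (ℕ → Fin m) => iterate V Φ η q.1 q.2 t := by
  induction t with
  | zero => simp [iterate]
  | succ t ih =>
    rcases Nat.eq_zero_or_pos t with rfl | ht
    · simp [iterate]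
    · simp_rw [iterate_succ ht]
      have hz : Measurable fun q : (Fin m → X × Y) × (ℕ → Fin m) => q.1 (q.2 t) :=
        (measurable_from_prod_countable_left (f := fun r : (Fin m → X × Y) × Fin m => r.1 r.2)
          fun i => measurable_pi_apply i).comp
          (measurable_fst.prodMk ((measurable_pi_apply t).comp measurable_snd))
      have hz1 : Measurable fun q : (Fin m → X × Y) × (ℕ → Fin m) => Φ (q.1 (q.2 t)).1 :=
        hΦ.comp hz.fst
      refine ih.sub (Measurable.smul (Measurable.const_mul ?_ _) hz1)
      exact hV.measurable_leftDeriv.comp (hz.snd.prodMk (ih.inner hz1))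

lemma measurable_average (hΦ : Measurable Φ) (hV : IsConvexLoss Y V) (t : ℕ) :
    Measurable fun q : (Fin m → X × Y) × (ℕ → Fin m) => average V Φ η q.1 q.2 t :=
  (Finset.measurable_fun_sum _ fun k _ => (measurable_iterate hΦ hV k).const_smul (η k)).const_smul _

variable [NeZero m]

/-- The expected empirical risk of the `k`-th iterate, given the sample. -/
def meanEmpRisk (V : ℝ → ℝ → ℝ) (Φ : X → F) (η : ℕ → ℝ) (z : Fin m → X × Y) (k : ℕ) : ℝ :=
  ∫ j, empRisk V Φ z (iterate V Φ η z j k) ∂(indexLaw m)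

/-- The comparator is random but must not see index `t`; this is what admits earlier iterates as
comparators. -/
lemma integral_norm_iterate_succ_sub_sq_le (hΦ : Measurable Φ) (hV : IsConvexLoss Y V)
    (hB : IsBounded Y V Φ κ a₀ V₀) (hη : ∀ t, 1 ≤ t → 0 ≤ η t ∧ η t ≤ 1) (z : Fin m → X × Y)
    {t : ℕ} (ht : 1 ≤ t) (U : (ℕ → Fin m) → F) (hU : Measurable U)
    (hUt : ∀ i j, U (shiftIndex t i j) = U j) {R : ℝ} (hR : ∀ j, ‖U j‖ ≤ R) :
    ∫ j, ‖iterate V Φ η z j (t + 1) - U j‖ ^ 2 ∂(indexLaw m) ≤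
      ∫ j, ‖iterate V Φ η z j t - U j‖ ^ 2 ∂(indexLaw m) + η t ^ 2 * (a₀ * κ) ^ 2 +
        2 * η t * (∫ j, empRisk V Φ z (U j) ∂(indexLaw m) - meanEmpRisk V Φ η z t) := by
  have hw (k : ℕ) : Measurable fun j => iterate V Φ η z j k :=
    (measurable_iterate hΦ hV k).comp (measurable_const.prodMk measurable_id)
  have hw_le (j) {k : ℕ} (hk : 1 ≤ k) := norm_iterate_le hV hB hη z j hk le_rfl
  have hnorm {k : ℕ} (hk : 1 ≤ k) :
      Integrable (fun j => ‖iterate V Φ η z j k - U j‖ ^ 2) (indexLaw m) := by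
    refine integrable_of_measurable_of_abs_le (((hw k).sub hU).norm.pow_const 2)
      (B := (normBound κ a₀ V₀ η k + R) ^ 2) fun j => ?_
    rw [abs_of_nonneg (by positivity)]
    exact pow_le_pow_left₀ (norm_nonneg _)
      ((norm_sub_le _ _).trans (add_le_add (hw_le j hk) (hR j))) 2
  have hpl {u : (ℕ → Fin m) → F} (hu : Measurable u) {R : ℝ} (huR : ∀ j, ‖u j‖ ≤ R) :
      Integrable (fun j => pointLoss V Φ (u j) (z (j t))) (indexLaw m) := by
    refine integrable_of_measurable_of_abs_le ?_ fun j => abs_pointLoss_le hV hB (huR j) _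
    exact (measurable_pointLoss hΦ hV).comp
      (hu.prodMk ((measurable_of_finite z).comp (measurable_pi_apply t)))
  have heval {u : (ℕ → Fin m) → F} (hu : Measurable u) {R : ℝ} (huR : ∀ j, ‖u j‖ ≤ R)
      (hut : ∀ i j, u (shiftIndex t i j) = u j) :
      ∫ j, pointLoss V Φ (u j) (z (j t)) ∂(indexLaw m) =
        ∫ j, empRisk V Φ z (u j) ∂(indexLaw m) :=
    integral_indexLaw_eval t u hu hut (fun i w => pointLoss V Φ w (z i))
      (fun i => (measurable_pointLoss hΦ hV).comp (measurable_id.prodMk measurable_const))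
      fun i j => abs_pointLoss_le hV hB (huR j) _
  have hi1 := hnorm ht
  have hi2 := hpl hU hR
  have hi3 := hpl (hw t) fun j => hw_le j ht
  have hi4 : Integrable (fun j => 2 * η t * (pointLoss V Φ (U j) (z (j t)) -
      pointLoss V Φ (iterate V Φ η z j t) (z (j t)))) (indexLaw m) := (hi2.sub hi3).const_mul _
  have hmono := integral_mono (hnorm (ht.trans t.le_succ)) ((hi1.add (integrable_const _)).add hi4)
    fun j => norm_iterate_succ_sub_sq_le hV hB ht (hη t ht).1 z j (U j)
  refine hmono.trans_eq ?_
  rw [integral_add' (hi1.add (integrable_const _)) hi4, integral_add' hi1 (integrable_const _),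
    integral_const_mul (2 * η t), integral_sub hi2 hi3, heval hU hR hUt,
    heval (hw t) (fun j => hw_le j ht) fun i j => iterate_shiftIndex z j le_rfl i]
  simp [meanEmpRisk]

/-- The regret inequality of the iterates from time `s` on. -/
lemma sum_mul_meanEmpRisk_sub_le (hΦ : Measurable Φ) (hV : IsConvexLoss Y V)
    (hB : IsBounded Y V Φ κ a₀ V₀) (hη : ∀ t, 1 ≤ t → 0 ≤ η t ∧ η t ≤ 1) (z : Fin m → X × Y)
    {s t : ℕ} (hs : 1 ≤ s) (hst : s ≤ t) (U : (ℕ → Fin m) → F) (hU : Measurable U)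
    (hUt : ∀ k, s ≤ k → ∀ i j, U (shiftIndex k i j) = U j) {R : ℝ} (hR : ∀ j, ‖U j‖ ≤ R) :
    ∑ k ∈ Finset.Icc s t, η k *
        (meanEmpRisk V Φ η z k - ∫ j, empRisk V Φ z (U j) ∂(indexLaw m)) ≤
      (∫ j, ‖iterate V Φ η z j s - U j‖ ^ 2 ∂(indexLaw m)) / 2 +
        (a₀ * κ) ^ 2 / 2 * ∑ k ∈ Finset.Icc s t, η k ^ 2 := by
  -- Half the final squared distance stays on the left so that the one-step inequality telescopes;
  -- being nonnegative, it is dropped at the end.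
  suffices H : ∀ t, s ≤ t + 1 → ∑ k ∈ Finset.Ico s (t + 1), η k *
        (meanEmpRisk V Φ η z k - ∫ j, empRisk V Φ z (U j) ∂(indexLaw m)) +
        (∫ j, ‖iterate V Φ η z j (t + 1) - U j‖ ^ 2 ∂(indexLaw m)) / 2 ≤
      (∫ j, ‖iterate V Φ η z j s - U j‖ ^ 2 ∂(indexLaw m)) / 2 +
        (a₀ * κ) ^ 2 / 2 * ∑ k ∈ Finset.Ico s (t + 1), η k ^ 2 by
    have h := H t (hst.trans t.le_succ)
    have h0 : 0 ≤ ∫ j, ‖iterate V Φ η z j (t + 1) - U j‖ ^ 2 ∂(indexLaw m) :=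
      integral_nonneg fun j => by positivity
    rw [← Finset.Ico_add_one_right_eq_Icc]
    linarith
  suffices H : ∀ t, s ≤ t → ∑ k ∈ Finset.Ico s t, η k *
        (meanEmpRisk V Φ η z k - ∫ j, empRisk V Φ z (U j) ∂(indexLaw m)) +
        (∫ j, ‖iterate V Φ η z j t - U j‖ ^ 2 ∂(indexLaw m)) / 2 ≤
      (∫ j, ‖iterate V Φ η z j s - U j‖ ^ 2 ∂(indexLaw m)) / 2 +
        (a₀ * κ) ^ 2 / 2 * ∑ k ∈ Finset.Ico s t, η k ^ 2 from fun t ht => H _ ht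
  intro t ht
  induction t, ht using Nat.le_induction with
  | base => simp
  | succ t ht ih =>
    have h := integral_norm_iterate_succ_sub_sq_le hΦ hV hB hη z (hs.trans ht) U hU (hUt t ht) hR
    rw [Finset.sum_Ico_succ_top ht, Finset.sum_Ico_succ_top ht]
    linarith

end Iterates

/-! ### From weighted averages to the last iterate -/

section LastIterate

/-- From weighted averages over `[s, t]` to the last term of a sequence. -/
lemma last_le_weighted_average {a η : ℕ → ℝ} {M : ℝ} {t : ℕ} (hη : ∀ k, 1 ≤ k → 0 < η k)
    (h : ∀ s, 1 ≤ s → s ≤ t →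
      ∑ k ∈ Finset.Icc s t, η k * (a k - a s) ≤ M * ∑ k ∈ Finset.Icc s t, η k ^ 2)
    {s : ℕ} (hs : 1 ≤ s) (hst : s ≤ t) :
    a t ≤ (∑ k ∈ Finset.Icc s t, η k * a k) / (∑ k ∈ Finset.Icc s t, η k) +
      M * (η t - (∑ k ∈ Finset.Icc s t, η k ^ 2) / (∑ k ∈ Finset.Icc s t, η k) +
        ∑ r ∈ Finset.Ico s t, η r ^ 2 / ∑ k ∈ Finset.Icc (r + 1) t, η k) := by
  -- Induction on `t - s`. At `s = t` the average is `a t` and the bracket vanishes. Lowering `s` by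
  -- one changes the bound by a positive multiple of the slack in `h s`, which is the identity `key`
  -- below.
  obtain ⟨d, hd⟩ := Nat.exists_eq_add_of_le hst
  induction d generalizing s with
  | zero =>
    have := hη s hs
    obtain rfl : t = s := by omega
    simp only [Finset.Icc_self, Finset.sum_singleton, Finset.Ico_self, Finset.sum_empty]
    apply le_of_eq
    field_simp
    ring
  | succ d ih =>
    have hlt : s < t := by omega
    refine (ih (s := s + 1) (by omega) (by omega) (by omega)).trans ?_
    have hh := h s hs hst
    simp only [mul_sub, Finset.sum_sub_distrib, ← Finset.sum_mul] at hh
    rw [← Finset.sum_Ioc_add_eq_sum_Icc hst, ← Finset.sum_Ioc_add_eq_sum_Icc hst,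
      ← Finset.sum_Ioc_add_eq_sum_Icc hst] at hh ⊢
    rw [Finset.sum_eq_sum_Ico_succ_bot hlt, ← Finset.Icc_add_one_left_eq_Ioc] at *
    have hW : 0 < ∑ k ∈ Finset.Icc (s + 1) t, η k :=
      Finset.sum_pos (fun k hk => hη k (by have := Finset.mem_Icc.1 hk; omega))
        ⟨t, Finset.mem_Icc.2 ⟨hlt, le_rfl⟩⟩
    have he := hη s hs
    generalize ∑ r ∈ Finset.Ico (s + 1) t, η r ^ 2 / ∑ k ∈ Finset.Icc (r + 1) t, η k = D
    generalize ∑ k ∈ Finset.Icc (s + 1) t, η k = W at *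
    generalize ∑ k ∈ Finset.Icc (s + 1) t, η k ^ 2 = Q at *
    generalize ∑ k ∈ Finset.Icc (s + 1) t, η k * a k = N at *
    generalize η s = e at *
    have hWe : 0 < W + e := by linarith
    rw [← sub_nonneg]
    have key : (N + e * a s) / (W + e) +
        M * (η t - (Q + e ^ 2) / (W + e) + (e ^ 2 / W + D)) -
        (N / W + M * (η t - Q / W + D)) =
        e * (M * (Q + e ^ 2) - (N + e * a s - (W + e) * a s)) / (W * (W + e)) := by
      field_simp
      ring
    rw [key]
    refine div_nonneg (mul_nonneg he.le (by linarith)) (by positivity)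

lemma sum_Icc_one_div_le (t : ℕ) :
    ∑ k ∈ Finset.Icc 1 t, 1 / (k : ℝ) ≤ 1 + Real.log t := by
  have h := harmonic_le_one_add_log t
  rw [harmonic_eq_sum_Icc] at h
  push_cast at h
  simpa using h

variable {η : ℕ → ℝ} (hη : ∀ t : ℕ, 1 ≤ t → η t = 1 / √(t : ℝ))
include hη

lemma stepSize_pos {k : ℕ} (hk : 1 ≤ k) : 0 < η k := by
  rw [hη k hk]
  have : (0 : ℝ) < k := by exact_mod_cast hk
  positivity

lemma stepSize_le_one {k : ℕ} (hk : 1 ≤ k) : η k ≤ 1 := by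
  rw [hη k hk]
  have : (1 : ℝ) ≤ k := by exact_mod_cast hk
  rw [div_le_one (by positivity)]
  exact Real.one_le_sqrt.2 this

lemma stepSize_sq {k : ℕ} (hk : 1 ≤ k) : η k ^ 2 = 1 / (k : ℝ) := by
  rw [hη k hk, div_pow, one_pow, Real.sq_sqrt (by positivity)]

lemma le_sum_stepSize {s t : ℕ} (hs : 1 ≤ s) (hst : s ≤ t + 1) :
    ((t : ℝ) + 1 - s) / √t ≤ ∑ k ∈ Finset.Icc s t, η k := by
  have h : ∀ k ∈ Finset.Icc s t, 1 / √(t : ℝ) ≤ η k := fun k hk => by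
    obtain ⟨h1, h2⟩ := Finset.mem_Icc.1 hk
    rw [hη k (hs.trans h1)]
    have : (0 : ℝ) < k := by exact_mod_cast hs.trans h1
    have h3 : (k : ℝ) ≤ t := by exact_mod_cast h2
    gcongr
  have h2 := Finset.card_nsmul_le_sum _ _ _ h
  rw [Nat.card_Icc, nsmul_eq_mul, Nat.cast_sub hst] at h2
  push_cast at h2
  linarith [h2, div_eq_mul_one_div ((t : ℝ) + 1 - s) √t]

/-- Each tail sum is at least `(t - r) / √t`, and `√t / (r (t - r))` splits into partial fractions,
leaving two harmonic sums. -/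
lemma sum_sq_div_le {t : ℕ} (ht : 1 ≤ t) :
    ∑ r ∈ Finset.Ico 1 t, η r ^ 2 / ∑ k ∈ Finset.Icc (r + 1) t, η k ≤
      2 * (1 + Real.log t) / √t := by
  have ht0 : (0 : ℝ) < t := by exact_mod_cast ht
  have h1 : ∀ r ∈ Finset.Ico 1 t, η r ^ 2 / ∑ k ∈ Finset.Icc (r + 1) t, η k ≤
      1 / √t * (1 / (r : ℝ) + 1 / ((t - r : ℕ) : ℝ)) := fun r hr => by
    obtain ⟨hr1, hr2⟩ := Finset.mem_Ico.1 hr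
    have hr0 : (0 : ℝ) < r := by exact_mod_cast hr1
    have hrt : (r : ℝ) < t := by exact_mod_cast hr2
    have hW := le_sum_stepSize hη (s := r + 1) (t := t) (by omega) (by omega)
    push_cast at hW
    rw [stepSize_sq hη hr1, Nat.cast_sub hr2.le]
    have hd : 0 < (t : ℝ) - r := by linarith
    have hW0 : ((t : ℝ) + 1 - (r + 1)) / √t = (t - r) / √t := by ring
    rw [hW0] at hW
    refine (div_le_div_of_nonneg_left (by positivity) (by positivity) hW).trans_eq ?_
    have hs : √(t : ℝ) * √t = t := Real.mul_self_sqrt ht0.le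
    field_simp
    rw [sq, hs]
    ring
  refine (Finset.sum_le_sum h1).trans ?_
  rw [← Finset.mul_sum, Finset.sum_add_distrib]
  have h2 : ∑ r ∈ Finset.Ico 1 t, 1 / ((t - r : ℕ) : ℝ) = ∑ r ∈ Finset.Ico 1 t, 1 / (r : ℝ) := by
    refine Finset.sum_nbij' (fun r => t - r) (fun r => t - r) ?_ ?_ ?_ ?_ ?_ <;>
      intro r hr <;> simp only [Finset.mem_Ico] at * <;> omega
  have h3 : ∑ r ∈ Finset.Ico 1 t, 1 / (r : ℝ) ≤ 1 + Real.log t :=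
    (Finset.sum_le_sum_of_subset_of_nonneg Finset.Ico_subset_Icc_self
      fun _ _ _ => by positivity).trans (sum_Icc_one_div_le t)
  rw [h2, one_div_mul_eq_div]
  gcongr
  linarith

/-- Optimization bounds for the weighted average and for the last term of a sequence that
satisfies the regret inequalities. -/
lemma weighted_average_le_and_last_le {a : ℕ → ℝ} {M e n : ℝ} {t : ℕ} (ht : 1 ≤ t)
    (hM : 0 ≤ M) (hn : 0 ≤ n)
    (h0 : ∑ k ∈ Finset.Icc 1 t, η k * (a k - e) ≤ n + M * ∑ k ∈ Finset.Icc 1 t, η k ^ 2)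
    (h : ∀ s, 1 ≤ s → s ≤ t →
      ∑ k ∈ Finset.Icc s t, η k * (a k - a s) ≤ M * ∑ k ∈ Finset.Icc s t, η k ^ 2) :
    (∑ k ∈ Finset.Icc 1 t, η k * a k) / (∑ k ∈ Finset.Icc 1 t, η k) ≤
        e + n / √t + M * (4 + 3 * Real.log t) / √t ∧
      a t ≤ e + n / √t + M * (4 + 3 * Real.log t) / √t := by
  have ht0 : (0 : ℝ) < t := by exact_mod_cast ht
  have hlog : 0 ≤ Real.log t := Real.log_nonneg (by exact_mod_cast ht)
  have hs : √(t : ℝ) * √t = t := Real.mul_self_sqrt ht0.le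
  have hW : √(t : ℝ) ≤ ∑ k ∈ Finset.Icc 1 t, η k := by
    refine le_trans (le_of_eq ?_) (le_sum_stepSize hη le_rfl (by omega))
    push_cast
    field_simp
    linarith
  have hsq : ∑ k ∈ Finset.Icc 1 t, η k ^ 2 ≤ 1 + Real.log t := by
    refine (Finset.sum_congr rfl fun k hk => stepSize_sq hη (Finset.mem_Icc.1 hk).1).trans_le ?_
    exact sum_Icc_one_div_le t
  have hs0 : 0 < √(t : ℝ) := by positivity
  have hW0 := hs0.trans_le hW
  have hA : (∑ k ∈ Finset.Icc 1 t, η k * a k) / (∑ k ∈ Finset.Icc 1 t, η k) ≤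
      e + (n + M * (1 + Real.log t)) / √t := by
    simp only [mul_sub, Finset.sum_sub_distrib, ← Finset.sum_mul] at h0
    have h1 : (∑ k ∈ Finset.Icc 1 t, η k * a k) / (∑ k ∈ Finset.Icc 1 t, η k) - e ≤
        (n + M * (1 + Real.log t)) / ∑ k ∈ Finset.Icc 1 t, η k := by
      rw [div_sub' hW0.ne']
      gcongr
      exact h0.trans (by gcongr)
    have h2 : (n + M * (1 + Real.log t)) / ∑ k ∈ Finset.Icc 1 t, η k ≤
        (n + M * (1 + Real.log t)) / √t := by gcongr
    linarith
  have hlast := last_le_weighted_average (fun k hk => stepSize_pos hη hk) h le_rfl ht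
  have hD := sum_sq_div_le hη ht
  have hQ : 0 ≤ (∑ k ∈ Finset.Icc 1 t, η k ^ 2) / (∑ k ∈ Finset.Icc 1 t, η k) :=
    div_nonneg (Finset.sum_nonneg fun _ _ => sq_nonneg _) hW0.le
  have hηt := hη t ht
  constructor
  · refine hA.trans ?_
    rw [add_assoc, ← add_div]
    gcongr <;> linarith
  -- The nonpositive quotient is dropped. Adding `1 + log t` from the average, `1` from `η t` and `2
  -- (1 + log t)` from the tail sums gives `4 + 3 log t`.
  · have h3 : M * (η t - (∑ k ∈ Finset.Icc 1 t, η k ^ 2) / (∑ k ∈ Finset.Icc 1 t, η k) +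
        ∑ r ∈ Finset.Ico 1 t, η r ^ 2 / ∑ k ∈ Finset.Icc (r + 1) t, η k) ≤
        M * (1 / √t + 2 * (1 + Real.log t) / √t) := by
      gcongr
      linarith
    refine hlast.trans ((add_le_add hA h3).trans_eq ?_)
    ring

end LastIterate

/-! ### Generalization gap and error decomposition -/

section Generalization

variable {X F : Type*} [MeasurableSpace X] [NormedAddCommGroup F] [InnerProductSpace ℝ F]
  {Y : Set ℝ} {V : ℝ → ℝ → ℝ} {Φ : X → F} {κ a₀ V₀ : ℝ} {m : ℕ} [NeZero m]
  (ρ : Measure (X × Y)) [IsProbabilityMeasure ρ]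

lemma abs_risk_le (hV : IsConvexLoss Y V) (hB : IsBounded Y V Φ κ a₀ V₀) {w : F} {R : ℝ}
    (hw : ‖w‖ ≤ R) : |risk V Φ ρ w| ≤ V₀ + a₀ * κ * R := by
  have h := norm_integral_le_of_norm_le_const (μ := ρ) (f := pointLoss V Φ w)
    (Filter.Eventually.of_forall fun p => abs_pointLoss_le hV hB hw p)
  simpa [risk, pointLoss] using h

variable [MeasurableSpace F] [BorelSpace F] [SecondCountableTopology F]

lemma measurable_risk (hΦ : Measurable Φ) (hV : IsConvexLoss Y V) : Measurable (risk V Φ ρ) :=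
  (measurable_pointLoss hΦ hV).stronglyMeasurable.integral_prod_right'.measurable

lemma integral_empRisk (hΦ : Measurable Φ) (hV : IsConvexLoss Y V)
    (hB : IsBounded Y V Φ κ a₀ V₀) (w : F) :
    ∫ z : Fin m → X × Y, empRisk V Φ z w ∂(sampleLaw m ρ) = risk V Φ ρ w := by
  have hm : (m : ℝ) ≠ 0 := Nat.cast_ne_zero.2 (NeZero.ne m)
  have hw : Measurable (pointLoss (Y := Y) V Φ w) :=
    (measurable_pointLoss hΦ hV).comp (measurable_const.prodMk measurable_id)
  have hi (i : Fin m) : Integrable (fun z : Fin m → X × Y => pointLoss V Φ w (z i))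
      (sampleLaw m ρ) :=
    integrable_of_measurable_of_abs_le (hw.comp (measurable_pi_apply i))
      fun z => abs_pointLoss_le hV hB le_rfl _
  unfold empRisk
  rw [integral_const_mul, integral_finsetSum _ fun i _ => hi i,
    Finset.sum_congr rfl fun i _ => integral_sampleLaw_eval ρ i hw]
  simp [hm, risk, pointLoss]

/-- The expected generalization gap of a measurable selection in a ball. -/
lemma integral_risk_sub_empRisk_le (hΦ : Measurable Φ) (hV : IsConvexLoss Y V)
    (hB : IsBounded Y V Φ κ a₀ V₀) {R : ℝ} (g : (Fin m → X × Y) → F) (hg : Measurable g)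
    (hgR : ∀ z, ‖g z‖ ≤ R) :
    ∫ z, (risk V Φ ρ (g z) - empRisk V Φ z (g z)) ∂(sampleLaw m ρ) ≤
      2 * (a₀ * κ) * R / √m := by
  obtain ⟨p⟩ : Nonempty (X × Y) := ρ.nonempty_of_neZero
  have hm : (0 : ℝ) < m := Nat.cast_pos.2 (NeZero.pos m)
  have h := integral_sum_gap_le ρ (pointLoss V Φ) (measurable_pointLoss hΦ hV) {w : F | ‖w‖ ≤ R}
    (fun w hw p => abs_pointLoss_le hV hB hw p) (D := a₀ * R * |κ| * √m)
    (fun z w hw => by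
      simpa [pointLoss] using sum_boolSign_mul_le (fun i => V (z i).2) (fun i => Φ (z i).1)
        (hB.lipschitz_nonneg p) (fun i => hV.abs_sub_le (z i).2.2 (hB.deriv _ (z i).2.2))
        (fun i => hB.feature _) w hw) g hg hgR
  have e (z : Fin m → X × Y) : ∑ i, (∫ p, pointLoss V Φ (g z) p ∂ρ - pointLoss V Φ (g z) (z i)) =
      m * (risk V Φ ρ (g z) - empRisk V Φ z (g z)) := by
    rw [Finset.sum_sub_distrib, mul_sub, empRisk, mul_inv_cancel_left₀ hm.ne']
    simp [risk, pointLoss]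
  simp_rw [e] at h
  rw [integral_const_mul, abs_of_nonneg (hB.kappa_nonneg p)] at h
  have hs : √(m : ℝ) * √m = m := Real.mul_self_sqrt hm.le
  have hs0 : 0 < √(m : ℝ) := by positivity
  rw [le_div_iff₀ hs0]
  refine le_of_mul_le_mul_right ?_ hs0
  rw [mul_assoc, hs]
  linarith

/-- From an optimization bound for the empirical risk to an excess risk bound. -/
lemma expectedExcessRiskLE_of_empRisk (hΦ : Measurable Φ) (hV : IsConvexLoss Y V)
    (hB : IsBounded Y V Φ κ a₀ V₀) {R l B : ℝ} (g : (Fin m → X × Y) → (ℕ → Fin m) → F)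
    (hg : Measurable (Function.uncurry g)) (hgR : ∀ z j, ‖g z j‖ ≤ R)
    (h : ∀ z u, ∫ j, empRisk V Φ z (g z j) ∂(indexLaw m) ≤
      empRisk V Φ z u + l / 2 * ‖u‖ ^ 2 + B) :
    ExpectedExcessRiskLE V Φ ρ g
      (approxError V Φ ρ l + B + 2 * (a₀ * κ) * R / √m) := by
  have hrm : Measurable fun q : (Fin m → X × Y) × (ℕ → Fin m) => risk V Φ ρ (g q.1 q.2) :=
    (measurable_risk ρ hΦ hV).comp hg
  have hem : Measurable fun q : (Fin m → X × Y) × (ℕ → Fin m) => empRisk V Φ q.1 (g q.1 q.2) :=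
    (measurable_empRisk hΦ hV).comp (measurable_fst.prodMk hg)
  have hri := integrable_of_measurable_of_abs_le (μ := (sampleLaw m ρ).prod (indexLaw m)) hrm
    fun q => abs_risk_le ρ hV hB (hgR q.1 q.2)
  have hei := integrable_of_measurable_of_abs_le (μ := (sampleLaw m ρ).prod (indexLaw m)) hem
    fun q => abs_empRisk_le hV hB (hgR q.1 q.2) q.1
  have hxi : Integrable (fun q : (Fin m → X × Y) × (ℕ → Fin m) => excessRisk V Φ ρ (g q.1 q.2))
      ((sampleLaw m ρ).prod (indexLaw m)) := hri.sub (integrable_const _)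
  refine ⟨hxi, ?_⟩
  rw [integral_integral (f := fun z j => excessRisk V Φ ρ (g z j)) hxi]
  -- The sample and the indices are independent, so the sample can be integrated first with `j`
  -- frozen; `g · j` is then a deterministic selection in the ball.
  have hgap : ∫ q, (risk V Φ ρ (g q.1 q.2) - empRisk V Φ q.1 (g q.1 q.2))
      ∂((sampleLaw m ρ).prod (indexLaw m)) ≤ 2 * (a₀ * κ) * R / √m := by
    have hd : Integrable (fun q : (Fin m → X × Y) × (ℕ → Fin m) => risk V Φ ρ (g q.1 q.2) -
        empRisk V Φ q.1 (g q.1 q.2)) ((sampleLaw m ρ).prod (indexLaw m)) := hri.sub hei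
    rw [integral_prod_symm _ hd]
    refine (integral_mono hd.integral_prod_right
      (integrable_const (2 * (a₀ * κ) * R / √(m : ℝ))) fun j => ?_).trans_eq (by simp)
    exact integral_risk_sub_empRisk_le ρ hΦ hV hB (fun z => g z j)
      (hg.comp (measurable_id.prodMk measurable_const)) fun z => hgR z j
  have hemp (u : F) : ∫ q, empRisk V Φ q.1 (g q.1 q.2) ∂((sampleLaw m ρ).prod (indexLaw m)) ≤
      risk V Φ ρ u + l / 2 * ‖u‖ ^ 2 + B := by
    have hu : Integrable (fun z : Fin m → X × Y => empRisk V Φ z u) (sampleLaw m ρ) :=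
      integrable_of_measurable_of_abs_le
        ((measurable_empRisk hΦ hV).comp (measurable_id.prodMk measurable_const))
        fun z => abs_empRisk_le hV hB le_rfl z
    rw [integral_prod _ hei]
    have hu2 : Integrable (fun z : Fin m → X × Y => empRisk V Φ z u + (l / 2 * ‖u‖ ^ 2 + B))
      (sampleLaw m ρ) := hu.add (integrable_const _)
    refine (integral_mono hei.integral_prod_left hu2
      fun z => (h z u).trans_eq (add_assoc _ _ _)).trans_eq ?_
    rw [integral_add hu (integrable_const _), integral_empRisk ρ hΦ hV hB]
    simp [add_assoc]
  -- The bound holds for every fixed `u`, so the infimum is taken only after averaging over the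
  -- sample.
  have hinf : ∫ q, risk V Φ ρ (g q.1 q.2) ∂((sampleLaw m ρ).prod (indexLaw m)) - B -
      2 * (a₀ * κ) * R / √m ≤ ⨅ u : F, (risk V Φ ρ u + l / 2 * ‖u‖ ^ 2) := by
    refine le_ciInf fun u => ?_
    have h1 := hemp u
    rw [integral_sub hri hei] at hgap
    linarith
  have hx : ∫ q, excessRisk V Φ ρ (g q.1 q.2) ∂((sampleLaw m ρ).prod (indexLaw m)) =
      ∫ q, risk V Φ ρ (g q.1 q.2) ∂((sampleLaw m ρ).prod (indexLaw m)) -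
        ⨅ u : F, risk V Φ ρ u := by
    unfold excessRisk
    rw [integral_sub hri (integrable_const _)]
    simp
  rw [hx, approxError]
  linarith

lemma ExpectedExcessRiskLE.mono {X F : Type*} [MeasurableSpace X] [NormedAddCommGroup F]
    [InnerProductSpace ℝ F] {Y : Set ℝ} {m : ℕ} [NeZero m] {V : ℝ → ℝ → ℝ} {Φ : X → F}
    {ρ : Measure (X × Y)} {g : (Fin m → X × Y) → (ℕ → Fin m) → F} {B B' : ℝ}
    (h : ExpectedExcessRiskLE V Φ ρ g B) (hBB' : B ≤ B') : ExpectedExcessRiskLE V Φ ρ g B' :=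
  ⟨h.1, h.2.trans hBB'⟩

variable {η : ℕ → ℝ}

/-- Optimization bounds for the empirical risk of the average and of the last iterate. -/
lemma integral_empRisk_average_le_and_iterate_le (hΦ : Measurable Φ) (hV : IsConvexLoss Y V)
    (hB : IsBounded Y V Φ κ a₀ V₀) (hη : ∀ t : ℕ, 1 ≤ t → η t = 1 / √(t : ℝ))
    {t : ℕ} (ht : 1 ≤ t) (z : Fin m → X × Y) (u : F) :
    ∫ j, empRisk V Φ z (average V Φ η z j t) ∂(indexLaw m) ≤
        empRisk V Φ z u + (1 / √t) / 2 * ‖u‖ ^ 2 +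
          (a₀ * κ) ^ 2 / 2 * (4 + 3 * Real.log t) / √t ∧
      ∫ j, empRisk V Φ z (iterate V Φ η z j t) ∂(indexLaw m) ≤
        empRisk V Φ z u + (1 / √t) / 2 * ‖u‖ ^ 2 +
          (a₀ * κ) ^ 2 / 2 * (4 + 3 * Real.log t) / √t := by
  have hη01 : ∀ t, 1 ≤ t → 0 < η t ∧ η t ≤ 1 :=
    fun t ht => ⟨stepSize_pos hη ht, stepSize_le_one hη ht⟩
  have hη' : ∀ t, 1 ≤ t → 0 ≤ η t ∧ η t ≤ 1 := fun t ht => ⟨(hη01 t ht).1.le, (hη01 t ht).2⟩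
  have hw (k : ℕ) : Measurable fun j => iterate V Φ η z j k :=
    (measurable_iterate hΦ hV k).comp (measurable_const.prodMk measurable_id)
  have hemp {v : (ℕ → Fin m) → F} (hv : Measurable v) {R : ℝ} (hR : ∀ j, ‖v j‖ ≤ R) :
      Integrable (fun j => empRisk V Φ z (v j)) (indexLaw m) :=
    integrable_of_measurable_of_abs_le
      ((measurable_empRisk hΦ hV).comp (measurable_const.prodMk hv))
      fun j => abs_empRisk_le hV hB (hR j) z
  have h0 := sum_mul_meanEmpRisk_sub_le hΦ hV hB hη' z le_rfl ht (fun _ => u) measurable_const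
    (fun _ _ _ _ => rfl) fun _ => le_rfl
  have hs : ∀ s, 1 ≤ s → s ≤ t →
      ∑ k ∈ Finset.Icc s t, η k * (meanEmpRisk V Φ η z k - meanEmpRisk V Φ η z s) ≤
        (a₀ * κ) ^ 2 / 2 * ∑ k ∈ Finset.Icc s t, η k ^ 2 := fun s hs hst => by
    have h := sum_mul_meanEmpRisk_sub_le hΦ hV hB hη' z hs hst (fun j => iterate V Φ η z j s)
      (hw s) (fun k hk i j => iterate_shiftIndex z j hk i)
      fun j => norm_iterate_le hV hB hη' z j hs le_rfl
    simpa [meanEmpRisk] using h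
  -- Since `w₁ = 0`, the initial distance to `u` is `‖u‖`; divided by `√t`, this becomes the penalty
  -- with parameter `1/√t`.
  obtain ⟨h1, h2⟩ := weighted_average_le_and_last_le hη ht (M := (a₀ * κ) ^ 2 / 2)
    (e := empRisk V Φ z u) (n := ‖u‖ ^ 2 / 2) (by positivity) (by positivity)
    (by simpa [iterate_one] using h0) hs
  have e : ‖u‖ ^ 2 / 2 / √t = (1 / √t) / 2 * ‖u‖ ^ 2 := by ring
  rw [e] at h1 h2
  refine ⟨le_trans ?_ h1, h2⟩
  have hpos : 0 < ∑ k ∈ Finset.Icc 1 t, η k :=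
    Finset.sum_pos (fun k hk => (hη01 k (Finset.mem_Icc.1 hk).1).1) ⟨1, by simp [ht]⟩
  have hit {k : ℕ} (hk : k ∈ Finset.Icc 1 t) : Integrable (fun j =>
      η k / (∑ k ∈ Finset.Icc 1 t, η k) * empRisk V Φ z (iterate V Φ η z j k)) (indexLaw m) :=
    (hemp (hw k) fun j =>
      norm_iterate_le hV hB hη' z j (Finset.mem_Icc.1 hk).1 le_rfl).const_mul _
  have hconv (j : ℕ → Fin m) : empRisk V Φ z (average V Φ η z j t) ≤
      ∑ k ∈ Finset.Icc 1 t, η k / (∑ k ∈ Finset.Icc 1 t, η k) *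
        empRisk V Φ z (iterate V Φ η z j k) := by
    have h := (convexOn_empRisk (Φ := Φ) hV z).map_sum_le (t := Finset.Icc 1 t)
      (w := fun k => η k / (∑ k ∈ Finset.Icc 1 t, η k)) (p := fun k => iterate V Φ η z j k)
      (fun k hk => div_nonneg (hη' k (Finset.mem_Icc.1 hk).1).1 hpos.le)
      (by rw [← Finset.sum_div, div_self hpos.ne']) fun _ _ => Set.mem_univ _
    refine le_of_eq_of_le (congrArg _ ?_) h
    rw [average, Finset.smul_sum]
    refine Finset.sum_congr rfl fun k _ => ?_
    rw [smul_smul, div_eq_inv_mul]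
  refine (integral_mono (hemp ((measurable_average hΦ hV t).comp
    (measurable_const.prodMk measurable_id)) fun j => norm_average_le hV hB hη01 z j ht)
    (integrable_finsetSum _ fun k hk => hit hk) hconv).trans_eq ?_
  rw [integral_finsetSum _ fun k hk => hit hk, Finset.sum_div]
  refine Finset.sum_congr rfl fun k _ => ?_
  rw [integral_const_mul, meanEmpRisk]
  ring

end Generalization

/-! ### Explicit rates and the stopping time -/

section Rates

lemma sum_stepSize_le {η : ℕ → ℝ} (hη : ∀ t : ℕ, 1 ≤ t → η t = 1 / √(t : ℝ)) (t : ℕ) :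
    ∑ k ∈ Finset.Ico 1 (t + 1), η k ≤ 2 * √t := by
  induction t with
  | zero => simp
  | succ t ih =>
    rw [Finset.sum_Ico_succ_top (by omega), hη _ (by omega)]
    have h1 : √((t + 1 : ℕ) : ℝ) ^ 2 = (t : ℝ) + 1 := by
      rw [Real.sq_sqrt (by positivity)]; push_cast; rfl
    have h2 : √(t : ℝ) ^ 2 = t := Real.sq_sqrt (by positivity)
    have h3 : 0 < √((t + 1 : ℕ) : ℝ) := by positivity
    have h4 : 1 / √((t + 1 : ℕ) : ℝ) ≤ 2 * √((t + 1 : ℕ) : ℝ) - 2 * √t := by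
      rw [div_le_iff₀ h3]
      nlinarith [sq_nonneg (√((t + 1 : ℕ) : ℝ) - √t)]
    linarith

lemma one_le_two_mul_log {x : ℝ} (hx : 2 ≤ x) : 1 ≤ 2 * Real.log x := by
  have h1 := Real.log_two_gt_d9
  have h2 := Real.log_le_log (by norm_num) hx
  linarith

/-- The logarithm is inserted to match the target rate. It is harmless at `t = 1`, where the sum is
empty and both sides vanish, and for `t ≥ 2` because `1 ≤ 2 log t`. -/
lemma normBound_le {κ a₀ V₀ : ℝ} (hV₀ : 0 ≤ V₀) {η : ℕ → ℝ}
    (hη : ∀ t : ℕ, 1 ≤ t → η t = 1 / √(t : ℝ)) {t : ℕ} (ht : 1 ≤ t) :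
    normBound κ a₀ V₀ η t ≤
      2 * √(((a₀ * κ) ^ 2 + 2 * V₀) * 2) * ((t : ℝ) ^ (1 / 4 : ℝ) * Real.log t) := by
  rcases ht.eq_or_lt with rfl | h2
  · simp [normBound]
  have ht0 : (0 : ℝ) < t := by exact_mod_cast ht
  have hlog := one_le_two_mul_log (x := t) (by exact_mod_cast h2)
  have hS : ∑ k ∈ Finset.Ico 1 t, η k ≤ 2 * √t := by
    refine (Finset.sum_le_sum_of_subset_of_nonneg (Finset.Ico_subset_Ico_right t.le_succ)
      fun k hk _ => (stepSize_pos hη (Finset.mem_Ico.1 hk).1).le).trans (sum_stepSize_le hη t)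
  have hq : √(√(t : ℝ)) = (t : ℝ) ^ (1 / 4 : ℝ) := by
    rw [Real.sqrt_eq_rpow, Real.sqrt_eq_rpow, ← Real.rpow_mul ht0.le]
    norm_num
  calc normBound κ a₀ V₀ η t ≤ √(((a₀ * κ) ^ 2 + 2 * V₀) * 2 * √t) := by
        unfold normBound
        rw [mul_assoc]
        gcongr
    _ = √(((a₀ * κ) ^ 2 + 2 * V₀) * 2) * (t : ℝ) ^ (1 / 4 : ℝ) * 1 := by
        rw [Real.sqrt_mul (by positivity), hq, mul_one]
    _ ≤ √(((a₀ * κ) ^ 2 + 2 * V₀) * 2) * (t : ℝ) ^ (1 / 4 : ℝ) * (2 * Real.log t) := by gcongr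
    _ = _ := by ring

/-- The constant in the bounds for a fixed number of iterations. -/
def rateConst (κ a₀ V₀ c : ℝ) : ℝ :=
  |c| + 4 * (a₀ * κ) ^ 2 + 4 * |a₀ * κ| * √(((a₀ * κ) ^ 2 + 2 * V₀) * 2) + 1

/-- The absolute values and the `+ 1` ensure positivity for all real parameters, since the constant
is chosen before any hypothesis fixes their signs. -/
lemma rateConst_pos (κ a₀ V₀ c : ℝ) : 0 < rateConst κ a₀ V₀ c := by
  unfold rateConst; positivity

/-- The part of the optimization error without a logarithm is of order `1/√t`; it is absorbed into
`t^(-β/2)`, using `β ≤ 1`, because the logarithmic terms vanish at `t = 1`. -/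
lemma error_sum_le {κ a₀ V₀ c β D : ℝ} (hL : 0 ≤ a₀ * κ) (hV₀ : 0 ≤ V₀) (hβ1 : β ≤ 1)
    {η : ℕ → ℝ} (hη : ∀ t : ℕ, 1 ≤ t → η t = 1 / √(t : ℝ)) (m : ℕ) {t : ℕ} (ht : 1 ≤ t)
    (hD : D ≤ c * (1 / √(t : ℝ)) ^ β) :
    D + (a₀ * κ) ^ 2 / 2 * (4 + 3 * Real.log t) / √t +
        2 * (a₀ * κ) * normBound κ a₀ V₀ η t / √m ≤
      rateConst κ a₀ V₀ c * ((t : ℝ) ^ (1 / 4 : ℝ) * Real.log t / √(m : ℝ) +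
        Real.log t / √(t : ℝ) + 1 / (t : ℝ) ^ (β / 2)) := by
  have ht1 : (1 : ℝ) ≤ t := by exact_mod_cast ht
  have ht0 : (0 : ℝ) < t := by linarith
  have hlog : 0 ≤ Real.log t := Real.log_nonneg ht1
  have hN := normBound_le (κ := κ) (a₀ := a₀) hV₀ hη ht
  have hpow : (1 / √(t : ℝ)) ^ β = 1 / (t : ℝ) ^ (β / 2) := by
    rw [Real.div_rpow zero_le_one (Real.sqrt_nonneg _), Real.one_rpow, Real.sqrt_eq_rpow,
      ← Real.rpow_mul ht0.le]
    ring_nf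
  rw [hpow] at hD
  have hle : 1 / √(t : ℝ) ≤ 1 / (t : ℝ) ^ (β / 2) := by
    rw [Real.sqrt_eq_rpow]
    have := Real.rpow_le_rpow_of_exponent_le ht1 (show β / 2 ≤ 1 / 2 by linarith)
    gcongr
  have hA0 : 0 ≤ (t : ℝ) ^ (1 / 4 : ℝ) * Real.log t / √(m : ℝ) := by positivity
  have hB0 : 0 ≤ Real.log t / √(t : ℝ) := by positivity
  have hC0 : 0 ≤ 1 / (t : ℝ) ^ (β / 2) := by positivity
  set K := √(((a₀ * κ) ^ 2 + 2 * V₀) * 2) with hK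
  have hK0 : 0 ≤ K := Real.sqrt_nonneg _
  have h1 : 2 * (a₀ * κ) * normBound κ a₀ V₀ η t / √m ≤
      4 * (a₀ * κ) * K * ((t : ℝ) ^ (1 / 4 : ℝ) * Real.log t / √(m : ℝ)) := by
    refine (div_le_div_of_nonneg_right (mul_le_mul_of_nonneg_left hN (by positivity))
      (Real.sqrt_nonneg _)).trans_eq ?_
    ring
  have h2 : (a₀ * κ) ^ 2 / 2 * (4 + 3 * Real.log t) / √t ≤
      2 * (a₀ * κ) ^ 2 * (1 / (t : ℝ) ^ (β / 2)) +
        3 / 2 * (a₀ * κ) ^ 2 * (Real.log t / √t) := by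
    have := mul_le_mul_of_nonneg_left hle (show 0 ≤ 2 * (a₀ * κ) ^ 2 by positivity)
    refine le_trans (le_of_eq ?_) (add_le_add_left this _)
    ring
  rw [rateConst, abs_of_nonneg hL, ← hK]
  generalize (t : ℝ) ^ (1 / 4 : ℝ) * Real.log t / √(m : ℝ) = A at *
  generalize Real.log t / √(t : ℝ) = B at *
  generalize 1 / (t : ℝ) ^ (β / 2) = E at *
  have hLK : 0 ≤ 4 * (a₀ * κ) * K := by positivity
  have hL2 : 0 ≤ (a₀ * κ) ^ 2 := sq_nonneg _
  have hc : c * E ≤ |c| * E := mul_le_mul_of_nonneg_right (le_abs_self c) hC0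
  have g1 : 4 * (a₀ * κ) * K * A ≤ (|c| + 4 * (a₀ * κ) ^ 2 + 4 * (a₀ * κ) * K + 1) * A :=
    mul_le_mul_of_nonneg_right (by linarith [abs_nonneg c]) hA0
  have g2 : 3 / 2 * (a₀ * κ) ^ 2 * B ≤
      (|c| + 4 * (a₀ * κ) ^ 2 + 4 * (a₀ * κ) * K + 1) * B :=
    mul_le_mul_of_nonneg_right (by linarith [abs_nonneg c]) hB0
  have g3 : (|c| + 2 * (a₀ * κ) ^ 2) * E ≤
      (|c| + 4 * (a₀ * κ) ^ 2 + 4 * (a₀ * κ) * K + 1) * E :=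
    mul_le_mul_of_nonneg_right (by linarith) hC0
  rw [mul_add (|c| + _ + _ + 1), mul_add (|c| + _ + _ + 1)]
  linarith

/-- The choice of `t` balances `t^(1/4) / √m` against `t^(-β/2)`. Rounding up at most doubles `t`,
so `log t ≤ 3 log m`, and the three terms contribute `6 + 3 + 2 = 11`. -/
lemma rate_at_stopping_time_le {β : ℝ} (hβ : 0 < β) (hβ1 : β ≤ 1) {m : ℕ} (hm : 2 ≤ m) {t : ℕ}
    (ht : t = ⌈(m : ℝ) ^ (2 / (2 * β + 1))⌉₊) :
    (t : ℝ) ^ (1 / 4 : ℝ) * Real.log t / √(m : ℝ) + Real.log t / √(t : ℝ) +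
        1 / (t : ℝ) ^ (β / 2) ≤
      11 * ((m : ℝ) ^ (-(β / (2 * β + 1))) * Real.log m) := by
  have hm2 : (2 : ℝ) ≤ m := by exact_mod_cast hm
  have hm1 : (1 : ℝ) ≤ m := by linarith
  have hm0 : (0 : ℝ) < m := by linarith
  have hg : 0 < 2 * β + 1 := by linarith
  set x : ℝ := (m : ℝ) ^ (2 / (2 * β + 1)) with hx
  have hx1 : 1 ≤ x := Real.one_le_rpow hm1 (by positivity)
  have hx0 : 0 < x := by linarith
  have hxt : x ≤ t := ht ▸ Nat.le_ceil x
  have htx : (t : ℝ) ≤ 2 * x := by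
    have := Nat.ceil_lt_add_one hx0.le
    rw [← ht] at this
    linarith
  have ht1 : (1 : ℝ) ≤ t := hx1.trans hxt
  have ht0 : (0 : ℝ) < t := by linarith
  have hlogm := one_le_two_mul_log hm2
  have hlogm0 : 0 ≤ Real.log m := by linarith
  have hlogt0 : 0 ≤ Real.log t := Real.log_nonneg ht1
  have hlogt : Real.log t ≤ 3 * Real.log m := by
    have h1 := Real.log_le_log ht0 htx
    rw [Real.log_mul two_ne_zero hx0.ne', hx, Real.log_rpow hm0] at h1
    have h2 : 2 / (2 * β + 1) ≤ 2 := div_le_self (by norm_num) (by linarith)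
    have h3 := mul_le_mul_of_nonneg_right h2 hlogm0
    have h4 := Real.log_le_log two_pos hm2
    linarith
  set r : ℝ := (m : ℝ) ^ (-(β / (2 * β + 1))) with hr
  have hr0 : 0 < r := by positivity
  have e1 : (t : ℝ) ^ (1 / 4 : ℝ) / √(m : ℝ) ≤ 2 * r := by
    have h1 : (t : ℝ) ^ (1 / 4 : ℝ) ≤ 2 * x ^ (1 / 4 : ℝ) := by
      refine (Real.rpow_le_rpow ht0.le htx (by norm_num)).trans ?_
      rw [Real.mul_rpow (by norm_num) hx0.le]
      gcongr
      exact Real.rpow_le_self_of_one_le (by norm_num) (by norm_num)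
    have h2 : x ^ (1 / 4 : ℝ) / √(m : ℝ) = r := by
      rw [hx, hr, ← Real.rpow_mul hm0.le, Real.sqrt_eq_rpow, ← Real.rpow_sub hm0]
      congr 1
      field_simp
      ring
    rw [← h2, ← mul_div_assoc]
    gcongr
  have e2 : 1 / √(t : ℝ) ≤ r := by
    have h1 : √x = (m : ℝ) ^ (1 / (2 * β + 1)) := by
      rw [Real.sqrt_eq_rpow, hx, ← Real.rpow_mul hm0.le]
      congr 1
      field_simp
    have h2 : (m : ℝ) ^ (β / (2 * β + 1)) ≤ √t := by
      refine le_trans ?_ (Real.sqrt_le_sqrt hxt)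
      rw [h1]
      exact Real.rpow_le_rpow_of_exponent_le hm1 (by gcongr)
    rw [hr, Real.rpow_neg hm0.le, ← one_div]
    gcongr
  have e3 : 1 / (t : ℝ) ^ (β / 2) ≤ r := by
    have h1 : x ^ (β / 2) = (m : ℝ) ^ (β / (2 * β + 1)) := by
      rw [hx, ← Real.rpow_mul hm0.le]
      congr 1
      field_simp
    rw [hr, Real.rpow_neg hm0.le, ← one_div, ← h1]
    gcongr
  have f1 : (t : ℝ) ^ (1 / 4 : ℝ) * Real.log t / √(m : ℝ) ≤ 2 * r * (3 * Real.log m) := by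
    rw [mul_div_right_comm]
    gcongr
  have f2 : Real.log t / √(t : ℝ) ≤ r * (3 * Real.log m) := by
    rw [div_eq_mul_one_div, mul_comm]
    gcongr
  have f3 : 1 / (t : ℝ) ^ (β / 2) ≤ r * (2 * Real.log m) :=
    e3.trans (le_mul_of_one_le_right hr0.le hlogm)
  linarith

end Rates

end SGM

end

theorem corollary6 (κ a₀ V₀ c : ℝ) :
    ∃ C : ℝ, 0 < C ∧
      ∀ (X : Type*) [MeasurableSpace X] (F : Type*) [NormedAddCommGroup F]
        [InnerProductSpace ℝ F] [CompleteSpace F] [TopologicalSpace.SeparableSpace F]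
        [MeasurableSpace F] [BorelSpace F]
        (Y : Set ℝ) (ρ : Measure (X × Y)) [IsProbabilityMeasure ρ]
        (V : ℝ → ℝ → ℝ) (Φ : X → F) (β : ℝ),
        Measurable Φ → SGM.IsConvexLoss Y V → SGM.IsBounded Y V Φ κ a₀ V₀ →
        SGM.ApproxErrorDecay V Φ ρ β c →
        ∀ (m : ℕ) [NeZero m] (η : ℕ → ℝ), (∀ t : ℕ, 1 ≤ t → η t = 1 / √(t : ℝ)) →
        -- the bounds for every number of iterations
          (∀ t : ℕ, 1 ≤ t →
            SGM.ExpectedExcessRiskLE V Φ ρ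
              (fun (z : Fin m → X × Y) j => SGM.average V Φ η z j t)
              (C * ((t : ℝ) ^ (1 / 4 : ℝ) * Real.log t / √(m : ℝ) + Real.log t / √(t : ℝ)
                + 1 / (t : ℝ) ^ (β / 2))) ∧
            SGM.ExpectedExcessRiskLE V Φ ρ
              (fun (z : Fin m → X × Y) j => SGM.iterate V Φ η z j t)
              (C * ((t : ℝ) ^ (1 / 4 : ℝ) * Real.log t / √(m : ℝ) + Real.log t / √(t : ℝ)
                + 1 / (t : ℝ) ^ (β / 2)))) ∧
        -- the rates for the stopping rule
          (2 ≤ m → ∀ t : ℕ, t = ⌈(m : ℝ) ^ (2 / (2 * β + 1))⌉₊ →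
            SGM.ExpectedExcessRiskLE V Φ ρ
              (fun (z : Fin m → X × Y) j => SGM.average V Φ η z j t)
              (C * ((m : ℝ) ^ (-(β / (2 * β + 1))) * Real.log m)) ∧
            SGM.ExpectedExcessRiskLE V Φ ρ
              (fun (z : Fin m → X × Y) j => SGM.iterate V Φ η z j t)
              (C * ((m : ℝ) ^ (-(β / (2 * β + 1))) * Real.log m))) := by
  refine ⟨11 * SGM.rateConst κ a₀ V₀ c, by have := SGM.rateConst_pos κ a₀ V₀ c; positivity, ?_⟩
  intro X _ F _ _ _ _ _ _ Y ρ _ V Φ β hΦ hV hB hD m _ η hη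
  have : SecondCountableTopology F := UniformSpace.secondCountable_of_separable F
  obtain ⟨hβ, hβ1, -, hD⟩ := hD
  -- A point of the probability space witnesses that `κ`, `a₀` and `V₀` are nonnegative.
  obtain ⟨p⟩ : Nonempty (X × Y) := ρ.nonempty_of_neZero
  have hC := SGM.rateConst_pos κ a₀ V₀ c
  have hη01 : ∀ t, 1 ≤ t → 0 < η t ∧ η t ≤ 1 :=
    fun t ht => ⟨SGM.stepSize_pos hη ht, SGM.stepSize_le_one hη ht⟩
  have main : ∀ t : ℕ, 1 ≤ t → ∀ B : ℝ,
      SGM.rateConst κ a₀ V₀ c * ((t : ℝ) ^ (1 / 4 : ℝ) * Real.log t / √(m : ℝ) +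
        Real.log t / √(t : ℝ) + 1 / (t : ℝ) ^ (β / 2)) ≤ B →
      SGM.ExpectedExcessRiskLE V Φ ρ
        (fun (z : Fin m → X × Y) j => SGM.average V Φ η z j t) B ∧
      SGM.ExpectedExcessRiskLE V Φ ρ
        (fun (z : Fin m → X × Y) j => SGM.iterate V Φ η z j t) B := by
    intro t ht B hB'
    have ht0 : (0 : ℝ) < t := by exact_mod_cast ht
    have herr := (SGM.error_sum_le (mul_nonneg (hB.lipschitz_nonneg p) (hB.kappa_nonneg p))
      (SGM.loss_zero_nonneg hV hB p) hβ1 hη m ht (hD (1 / √(t : ℝ)) (by positivity))).trans hB'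
    have hopt := SGM.integral_empRisk_average_le_and_iterate_le (m := m) hΦ hV hB hη ht
    exact ⟨(SGM.expectedExcessRiskLE_of_empRisk ρ hΦ hV hB _ (SGM.measurable_average hΦ hV t)
        (fun z j => SGM.norm_average_le hV hB hη01 z j ht) fun z u => (hopt z u).1).mono herr,
      (SGM.expectedExcessRiskLE_of_empRisk ρ hΦ hV hB _ (SGM.measurable_iterate hΦ hV t)
        (fun z j => SGM.norm_iterate_le hV hB
          (fun t ht => ⟨(hη01 t ht).1.le, (hη01 t ht).2⟩) z j ht le_rfl)
        fun z u => (hopt z u).2).mono herr⟩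
  refine ⟨fun t ht => main t ht _ ?_, fun hm t ht => main t ?_ _ ?_⟩
  · have : 0 ≤ Real.log (t : ℝ) := Real.log_nonneg (by exact_mod_cast ht)
    rw [mul_assoc]
    exact le_mul_of_one_le_left (by positivity) (by norm_num)
  · have : (0 : ℝ) < m := by exact_mod_cast (zero_lt_two.trans_le hm)
    rw [ht, Nat.one_le_ceil_iff]
    positivity
  · refine (mul_le_mul_of_nonneg_left
      (SGM.rate_at_stopping_time_le hβ hβ1 hm ht) hC.le).trans_eq ?_
    ring
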